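/- Let $\mathbb S^2\subset\mathbb R^3$ be the unit sphere with its surface measure $d\sigma$, tangential gradient $\nabla_\sigma$ and Laplace--Beltrami operator $\Delta_\sigma$. Let $(Y_\ell)_{\ell\ge 0}$ be an orthonormal basis of $L^2(\mathbb S^2)$ made of smooth eigenfunctions, $-\Delta_\sigma Y_\ell=\lambda_\ell Y_\ell$, and for $\nu\ge 0$ and $u\in L^2(\mathbb S^2)$ put $$\|u\|_{\dot H^{\nu}(\mathbb S^2)}:=\Big(\sum_{\ell\ge 0}\lambda_\ell^{\nu}\,|\langle u,Y_\ell\rangle|^2\Big)^{1/2}\in[0,\infty].$$ Then for every $s\in(0,1)$ there is a constant $C_s>0$ such that, for all smooth functions $g:\mathbb S^2\to[0,\infty)$, $$\|\sqrt g\|^2_{\dot H^{1+s}(\mathbb S^2)}+\|g\|_{L^1(\mathbb S^2)}\;\ge\; C_s\int_{\mathbb S^2} g(\sigma)\,|\nabla_\sigma\log g(\sigma)|^{2(1+s)}\,d\sigma ,$$ as an inequality in $[0,\infty]$, where the integrand on the right-hand side is taken to be $0$ at the points where $g$ vanishes. -/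

import Mathlib

open MeasureTheory
open scoped NNReal ENNReal Manifold ContDiff Laplacian

noncomputable section

namespace SphereSobolev

/-- The unit sphere `𝕊²` of Euclidean `ℝ³`. -/
abbrev S2 : Type := Metric.sphere (0 : EuclideanSpace ℝ (Fin 3)) 1

/-- The (non-normalised) surface measure `dσ` on `𝕊²`, of total mass `4π`. -/
abbrev surfaceMeasure : Measure S2 := (volume : Measure (EuclideanSpace ℝ (Fin 3))).toSphere

/-- The Hilbert space `L²(𝕊²)` of real functions. -/
abbrev L2 : Type := Lp ℝ 2 surfaceMeasure

/-- Smooth real functions on the manifold `𝕊²`. -/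
abbrev IsSmooth (g : S2 → ℝ) : Prop := ContMDiff (𝓡 2) 𝓘(ℝ, ℝ) ∞ g

/-- The radial projection `x ↦ x / |x|` of `ℝ³ ∖ {0}` onto `𝕊²`
(its value at `0` is a dummy and plays no role). -/
def radialProj (x : EuclideanSpace ℝ (Fin 3)) : S2 :=
  if hx : x = 0 then ⟨EuclideanSpace.single 0 1, by simp⟩
  else ⟨‖x‖⁻¹ • x, by simp [norm_smul, hx]⟩

/-- The extension of a function on `𝕊²` to `ℝ³ ∖ {0}` that is constant along rays. -/
def radialExt (g : S2 → ℝ) (x : EuclideanSpace ℝ (Fin 3)) : ℝ := g (radialProj x)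

/-- The spherical gradient `∇_σ g (σ)`, a vector of `σ^⊥ ⊆ ℝ³`: the Euclidean gradient at `σ`
of the extension of `g` that is constant along rays. -/
def sphGradient (g : S2 → ℝ) (σ : S2) : EuclideanSpace ℝ (Fin 3) :=
  gradient (radialExt g) (σ : EuclideanSpace ℝ (Fin 3))

/-- The Laplace–Beltrami operator `Δ_σ g (σ)`: the Euclidean Laplacian at `σ` of the extension
of `g` that is constant along rays. -/
def sphLaplacian (g : S2 → ℝ) (σ : S2) : ℝ :=
  Δ (radialExt g) (σ : EuclideanSpace ℝ (Fin 3))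

/-- The eigenspace in `L²(𝕊²)` of `-Δ_σ` for the value `lam`: the closed linear span of the
smooth `Y` with `-Δ_σ Y = lam Y`. It is `{0}` when `lam` is not an eigenvalue. -/
def eigenspace (lam : ℝ≥0) : Submodule ℝ L2 :=
  (Submodule.span ℝ {u : L2 | ∃ Y : S2 → ℝ, IsSmooth Y ∧
    (∀ σ, -sphLaplacian Y σ = lam * Y σ) ∧ u =ᵐ[surfaceMeasure] Y}).topologicalClosure

instance (lam : ℝ≥0) : CompleteSpace (eigenspace lam) :=
  (Submodule.isClosed_topologicalClosure _).completeSpace_coe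

/-- The homogeneous Sobolev seminorm of order `ν` on `𝕊²`, defined spectrally, with values in
`[0, ∞]`: `(∑ λ^ν ‖P_λ u‖²)^(1/2)`, where `P_λ` is the orthogonal projection of `L²(𝕊²)` onto the
`λ`-eigenspace of `-Δ_σ`. For an orthonormal basis `Y_ℓ` of eigenfunctions with eigenvalues `λ_ℓ`
this is `(∑ λ_ℓ^ν |⟨u, Y_ℓ⟩|²)^(1/2)`, the terms being grouped by eigenvalue; values `λ` that are
not eigenvalues contribute `0`. -/
def sobolevSeminorm (ν : ℝ) (u : L2) : ℝ≥0∞ :=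
  (∑' lam : ℝ≥0, ((lam ^ ν : ℝ≥0) : ℝ≥0∞) * ‖(eigenspace lam).starProjection u‖ₑ ^ 2) ^ (1 / 2 : ℝ)

/-- The square root of a smooth function on `𝕊²` is square integrable. -/
theorem memLp_sqrt {g : S2 → ℝ} (hg : IsSmooth g) :
    MemLp (fun σ => √(g σ)) 2 surfaceMeasure := by
  have hc : Continuous fun σ => √(g σ) := hg.continuous.sqrt
  obtain ⟨C, hC⟩ := (isCompact_range hc).isBounded.exists_norm_le
  exact MemLp.of_bound hc.aestronglyMeasurable C (Filter.Eventually.of_forall fun σ => hC _ ⟨σ, rfl⟩)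

/-- `√g` as an element of `L²(𝕊²)`. -/
def sqrtL2 (g : S2 → ℝ) (hg : IsSmooth g) : L2 := (memLp_sqrt hg).toLp

/-- `∫_{𝕊²} g |∇_σ log g|^{2(1+s)} dσ`, with values in `[0, ∞]`. The integrand is `0` where `g`
vanishes. -/
def fisherJ (s : ℝ) (g : S2 → ℝ) : ℝ≥0∞ :=
  ∫⁻ σ, ENNReal.ofReal
    (g σ * ‖sphGradient (fun τ => Real.log (g τ)) σ‖ ^ (2 * (1 + s))) ∂surfaceMeasure

end SphereSobolev

end

open MeasureTheory
open scoped NNReal ENNReal Manifold ContDiff Laplacian Pointwise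

noncomputable section

namespace SphereSobolev

/-! Put f = √g. Where g > 0, the integrand is 2^(2+2s) |∇f|^(2+2s) / f^(2s), and nine infinitesimal
rotations control |∇f|, so it suffices to estimate the derivative of f along the orbits of a
one-parameter group of rotations.

On one orbit the estimate is elementary (`neg_deriv_rpow_le`, `ofReal_deriv_rpow_le`). A nonnegative
function h with derivative k cannot descend steeply from a small value unless k changes soon, since
otherwise h would become negative. Quantitatively, |k(0)|^(2+2s) / h(0)^(2s) is at most a constant
times ∫ |k(u) - k(0)|² |u|^(-1-2s) du + h(0)². Integrated over the sphere, whose measure is rotation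
invariant, the last term yields the L¹ norm of g, and the double integral is a fractional norm of
order s of the derivative of f.

That norm is bounded spectrally. Rotations preserve each eigenspace of the Laplacian, and for the
rotation U_t one has ‖(U_t - 1)v‖² ≤ 2λt²‖v‖² on the λ-eigenspace. Two such differences and an
integration in u produce λ^(1+s) (`norm_mixedDiff_sq_le`, `lintegral_rpow_mul_min_le`). Summing over
λ requires the eigenspaces to be orthogonal and to span a dense subspace: symmetry of the Laplacian
gives the first, polynomials and Stone–Weierstrass the second
(`topologicalClosure_iSup_eigenspace`).

Since √g need not be differentiable where g vanishes, the orbit estimate is applied to the average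
of f over a flow time t, whose derivative is a difference quotient (`hasDerivAt_flowAvg`). The
bounds are uniform in t, and Fatou's lemma as t → 0 concludes (`lintegral_liminfQuot_le`). -/

/-- The ambient space `ℝ³`. -/
abbrev E3 : Type := EuclideanSpace ℝ (Fin 3)

/-! ### Rotations and invariance of the surface measure. -/

/-- A linear isometry of `ℝ³` acting on the unit sphere. -/
def rotate (R : E3 ≃ₗᵢ[ℝ] E3) (σ : S2) : S2 :=
  ⟨R σ, by simp⟩

@[simp] theorem coe_rotate (R : E3 ≃ₗᵢ[ℝ] E3) (σ : S2) : (rotate R σ : E3) = R σ := rfl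

theorem continuous_rotate (R : E3 ≃ₗᵢ[ℝ] E3) : Continuous (rotate R) := by
  unfold rotate; fun_prop

/-- The measure of a subset of the sphere is three times the volume of the truncated cone over it; a
linear isometry carries cones to cones and preserves volume. -/
theorem measurePreserving_rotate (R : E3 ≃ₗᵢ[ℝ] E3) :
    MeasurePreserving (rotate R) surfaceMeasure surfaceMeasure := by
  have hm : Measurable (rotate R) := (continuous_rotate R).measurable
  refine ⟨hm, ?_⟩
  ext s hs
  rw [Measure.map_apply hm hs, Measure.toSphere_apply' _ hs, Measure.toSphere_apply' _ (hm hs)]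
  congr 1
  have h : (Set.Ioo (0 : ℝ) 1 • ((↑) '' (rotate R ⁻¹' s) : Set E3)) =
      R ⁻¹' (Set.Ioo (0 : ℝ) 1 • ((↑) '' s : Set E3)) := by
    ext x
    simp only [Set.mem_smul, Set.mem_image, Set.mem_preimage]
    constructor
    · rintro ⟨r, hr, _, ⟨σ, hσ, rfl⟩, rfl⟩
      exact ⟨r, hr, _, ⟨_, hσ, rfl⟩, by simp⟩
    · rintro ⟨r, hr, _, ⟨σ, hσ, rfl⟩, hx⟩
      refine ⟨r, hr, _, ⟨rotate R.symm σ, ?_, rfl⟩, ?_⟩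
      · convert! hσ using 1
        ext1
        simp
      · apply R.injective
        simp [← hx]
  rw [h]
  exact R.measurePreserving.measure_preimage_emb R.toMeasurableEquiv.measurableEmbedding _

/-! ### One-parameter groups of isometries. -/

section RotationGroup

variable {V : Type*} [NormedAddCommGroup V] [InnerProductSpace ℝ V] [CompleteSpace V]

theorem exp_smul_mem_unitary (A : skewAdjoint (V →L[ℝ] V)) (t : ℝ) :
    NormedSpace.exp (t • (A : V →L[ℝ] V)) ∈ unitary (V →L[ℝ] V) :=
  let : NormedAlgebra ℚ (V →L[ℝ] V) := NormedAlgebra.restrictScalars ℚ ℝ _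
  NormedSpace.exp_mem_unitary_of_mem_skewAdjoint (skewAdjoint.smul_mem t A.2)

/-- The one-parameter group of isometries generated by a skew-adjoint operator. -/
def rotGroup (A : skewAdjoint (V →L[ℝ] V)) (t : ℝ) : V ≃ₗᵢ[ℝ] V :=
  Unitary.linearIsometryEquiv ⟨_, exp_smul_mem_unitary A t⟩

theorem rotGroup_apply (A : skewAdjoint (V →L[ℝ] V)) (t : ℝ) (x : V) :
    rotGroup A t x = NormedSpace.exp (t • (A : V →L[ℝ] V)) x := rfl

theorem rotGroup_zero (A : skewAdjoint (V →L[ℝ] V)) (x : V) : rotGroup A 0 x = x := by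
  simp [rotGroup_apply]

theorem rotGroup_add (A : skewAdjoint (V →L[ℝ] V)) (t u : ℝ) (x : V) :
    rotGroup A (t + u) x = rotGroup A t (rotGroup A u x) := by
  let : NormedAlgebra ℚ (V →L[ℝ] V) := NormedAlgebra.restrictScalars ℚ ℝ _
  rw [rotGroup_apply, rotGroup_apply, rotGroup_apply, add_smul, NormedSpace.exp_add_of_commute]
  · rfl
  · exact ((Commute.refl (A : V →L[ℝ] V)).smul_left t).smul_right u

theorem hasDerivAt_rotGroup (A : skewAdjoint (V →L[ℝ] V)) (x : V) (t : ℝ) :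
    HasDerivAt (fun u => rotGroup A u x) ((A : V →L[ℝ] V) (rotGroup A t x)) t := by
  have h := hasDerivAt_exp_smul_const' (𝕂 := ℝ) (A : V →L[ℝ] V) t
  simpa using! h.clm_apply (hasDerivAt_const t x)

theorem continuous_rotGroup (A : skewAdjoint (V →L[ℝ] V)) :
    Continuous fun p : ℝ × V => rotGroup A p.1 p.2 := by
  have : Continuous fun t : ℝ => NormedSpace.exp (t • (A : V →L[ℝ] V)) :=
    continuous_iff_continuousAt.2 fun t =>
      (hasDerivAt_exp_smul_const' (𝕂 := ℝ) (A : V →L[ℝ] V) t).continuousAt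
  exact (this.comp continuous_fst).clm_apply continuous_snd

end RotationGroup

/-! ### Rotation flows on the sphere and calculus through radial extensions. -/

/-- Skew-adjoint endomorphisms of `ℝ³`, that is, infinitesimal rotations. -/
abbrev Skew : Type := skewAdjoint (E3 →L[ℝ] E3)

/-- The flow on the sphere of the one-parameter group of rotations generated by `A`. -/
def flow (A : Skew) (t : ℝ) : S2 → S2 := rotate (rotGroup A t)

theorem measurePreserving_flow (A : Skew) (t : ℝ) :
    MeasurePreserving (flow A t) surfaceMeasure surfaceMeasure :=
  measurePreserving_rotate _

@[simp] theorem flow_zero (A : Skew) (σ : S2) : flow A 0 σ = σ :=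
  Subtype.ext (rotGroup_zero A _)

theorem flow_add (A : Skew) (t u : ℝ) (σ : S2) : flow A (t + u) σ = flow A t (flow A u σ) :=
  Subtype.ext (rotGroup_add A t u _)

theorem hasDerivAt_coe_flow (A : Skew) (σ : S2) (t : ℝ) :
    HasDerivAt (fun u => (flow A u σ : E3)) ((A : E3 →L[ℝ] E3) (flow A t σ)) t :=
  hasDerivAt_rotGroup A _ t

theorem continuous_flow (A : Skew) : Continuous fun p : ℝ × S2 => flow A p.1 p.2 :=
  Continuous.subtype_mk ((continuous_rotGroup A).comp
    (continuous_fst.prodMk (continuous_subtype_val.comp continuous_snd))) _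

theorem coe_ne_zero (σ : S2) : (σ : E3) ≠ 0 := ne_zero_of_mem_unit_sphere σ

theorem coe_radialProj {x : E3} (hx : x ≠ 0) : (radialProj x : E3) = ‖x‖⁻¹ • x := by
  simp [radialProj, hx]

theorem radialProj_smul_coe {c : ℝ} (hc : 0 < c) (σ : S2) : radialProj (c • (σ : E3)) = σ := by
  have h : c • (σ : E3) ≠ 0 := smul_ne_zero hc.ne' (coe_ne_zero σ)
  ext1
  rw [coe_radialProj h, norm_smul, norm_eq_of_mem_sphere σ, smul_smul, Real.norm_of_nonneg hc.le,
    mul_one, inv_mul_cancel₀ hc.ne', one_smul]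

theorem radialProj_coe (σ : S2) : radialProj (σ : E3) = σ := by
  simpa using radialProj_smul_coe one_pos σ

@[simp] theorem radialExt_coe (Y : S2 → ℝ) (σ : S2) : radialExt Y σ = Y σ := by
  simp [radialExt, radialProj_coe]

/-- Passes from smoothness on the manifold to Euclidean calculus: off the origin the radial
projection is a smooth map to the sphere. -/
theorem contDiffAt_radialExt {Y : S2 → ℝ} (hY : IsSmooth Y) {x : E3} (hx : x ≠ 0) :
    ContDiffAt ℝ ∞ (radialExt Y) x := by
  let U : TopologicalSpace.Opens E3 := ⟨{0}ᶜ, isOpen_compl_singleton⟩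
  have h1 : ContMDiff 𝓘(ℝ, E3) 𝓘(ℝ, E3) ∞ fun y : U => ‖(y : E3)‖⁻¹ • (y : E3) := by
    intro y
    have hy : (y : E3) ≠ 0 := y.2
    refine (contMDiffAt_subtype_iff (U := U) (f := fun z : E3 => ‖z‖⁻¹ • z)).2 ?_
    rw [contMDiffAt_iff_contDiffAt]
    exact ((contDiffAt_norm ℝ hy).inv (norm_ne_zero_iff.2 hy)).smul contDiffAt_id
  have h2 : ContMDiff 𝓘(ℝ, E3) (𝓡 2) ∞ fun y : U => radialProj (y : E3) := by
    have := Fact.mk (finrank_euclideanSpace_fin (𝕜 := ℝ) (n := 2 + 1))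
    have h0 : ∀ y : U, ‖(y : E3)‖⁻¹ • (y : E3) ∈ Metric.sphere (0 : E3) 1 := fun y => by
      rw [← coe_radialProj y.2]
      exact (radialProj _).2
    have heq : (fun y : U => radialProj (y : E3)) = Set.codRestrict _ _ h0 :=
      funext fun y => Subtype.ext (coe_radialProj y.2)
    rw [heq]
    exact ContMDiff.codRestrict_sphere (n := 2) h1 h0
  have h3 : ContMDiff 𝓘(ℝ, E3) 𝓘(ℝ, ℝ) ∞ fun y : U => radialExt Y (y : E3) := hY.comp h2
  have h4 := (contMDiffAt_subtype_iff (U := U) (f := radialExt Y) (x := ⟨x, hx⟩)).1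
    (h3.contMDiffAt)
  exact contMDiffAt_iff_contDiffAt.1 h4

theorem isSmooth_of_contDiffAt {F : E3 → ℝ} (hF : ∀ σ : S2, ContDiffAt ℝ ∞ F σ) :
    IsSmooth fun σ => F σ := by
  intro σ
  have := Fact.mk (finrank_euclideanSpace_fin (𝕜 := ℝ) (n := 2 + 1))
  have hc : ContMDiff (𝓡 2) 𝓘(ℝ, E3) ∞ fun τ : S2 => (τ : E3) :=
    contMDiff_coe_sphere (n := 2) (E := EuclideanSpace ℝ (Fin (2 + 1)))
  exact ContMDiffAt.comp σ (contMDiffAt_iff_contDiffAt.2 (hF σ)) hc.contMDiffAt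

/-- The derivative of a function on the sphere along the flow of rotations generated by `A`. -/
def lieDeriv (A : Skew) (Y : S2 → ℝ) (σ : S2) : ℝ :=
  fderiv ℝ (radialExt Y) σ ((A : E3 →L[ℝ] E3) σ)

theorem isSmooth_lieDeriv (A : Skew) {Y : S2 → ℝ} (hY : IsSmooth Y) : IsSmooth (lieDeriv A Y) := by
  refine isSmooth_of_contDiffAt (F := fun x => fderiv ℝ (radialExt Y) x ((A : E3 →L[ℝ] E3) x))
    fun σ => ?_
  exact ((contDiffAt_radialExt hY (coe_ne_zero σ)).fderiv_right (m := ∞) (by simp)).clm_apply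
    (A : E3 →L[ℝ] E3).contDiff.contDiffAt

theorem hasDerivAt_comp_flow_of_differentiableAt (A : Skew) {Y : S2 → ℝ} (σ : S2) (t : ℝ)
    (hY : DifferentiableAt ℝ (radialExt Y) (flow A t σ)) :
    HasDerivAt (fun u => Y (flow A u σ)) (lieDeriv A Y (flow A t σ)) t := by
  have h := hY.hasFDerivAt.comp_hasDerivAt t (hasDerivAt_coe_flow A σ t)
  simpa [Function.comp_def] using! h

theorem hasDerivAt_comp_flow (A : Skew) {Y : S2 → ℝ} (hY : IsSmooth Y) (σ : S2) (t : ℝ) :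
    HasDerivAt (fun u => Y (flow A u σ)) (lieDeriv A Y (flow A t σ)) t :=
  hasDerivAt_comp_flow_of_differentiableAt A σ t
    ((contDiffAt_radialExt hY (coe_ne_zero _)).differentiableAt (by simp))

theorem lieDeriv_mul (A : Skew) {Y Z : S2 → ℝ} (hY : IsSmooth Y) (hZ : IsSmooth Z) :
    lieDeriv A (Y * Z) = lieDeriv A Y * Z + Y * lieDeriv A Z := by
  ext σ
  have h1 := hasDerivAt_comp_flow A (hY.mul hZ) σ 0
  have h2 := (hasDerivAt_comp_flow A hY σ 0).mul (hasDerivAt_comp_flow A hZ σ 0)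
  have := h1.unique h2
  simpa using this

theorem differentiableAt_radialExt {Y : S2 → ℝ} (hY : IsSmooth Y) {x : E3} (hx : x ≠ 0) :
    DifferentiableAt ℝ (radialExt Y) x :=
  (contDiffAt_radialExt hY hx).differentiableAt (by simp)

theorem fderiv_radialExt_smul_coe {Y : S2 → ℝ} (σ : S2) {c : ℝ} (hc : 0 < c)
    (hY : DifferentiableAt ℝ (radialExt Y) (c • (σ : E3))) :
    fderiv ℝ (radialExt Y) (c • (σ : E3)) (σ : E3) = 0 := by
  have h1 : HasDerivAt (fun r : ℝ => r • (σ : E3)) (σ : E3) c := by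
    simpa using (hasDerivAt_id c).smul_const (σ : E3)
  have h2 := hY.hasFDerivAt.comp_hasDerivAt c h1
  have h3 : (radialExt Y ∘ fun r : ℝ => r • (σ : E3)) =ᶠ[nhds c] fun _ => Y σ := by
    filter_upwards [lt_mem_nhds hc] with r hr
    simp [radialExt, radialProj_smul_coe hr]
  exact h2.unique ((hasDerivAt_const c (Y σ)).congr_of_eventuallyEq h3)

theorem fderiv_radialExt_coe {Y : S2 → ℝ} (σ : S2) (hY : DifferentiableAt ℝ (radialExt Y) σ) :
    fderiv ℝ (radialExt Y) σ (σ : E3) = 0 := by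
  have h := fderiv_radialExt_smul_coe (Y := Y) σ one_pos (by rwa [one_smul])
  rwa [one_smul] at h

theorem hasDerivAt_fderiv_apply {V : Type*} [NormedAddCommGroup V] [NormedSpace ℝ V] {F : V → ℝ}
    {γ w : ℝ → V} {γ' w' : V} {t : ℝ} (hF : DifferentiableAt ℝ (fderiv ℝ F) (γ t))
    (hγ : HasDerivAt γ γ' t) (hw : HasDerivAt w w' t) :
    HasDerivAt (fun r => fderiv ℝ F (γ r) (w r))
      (fderiv ℝ (fderiv ℝ F) (γ t) γ' (w t) + fderiv ℝ F (γ t) w') t :=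
  (hF.hasFDerivAt.comp_hasDerivAt t hγ).clm_apply hw

theorem differentiableAt_fderiv_radialExt {Y : S2 → ℝ} (hY : IsSmooth Y) {x : E3} (hx : x ≠ 0) :
    DifferentiableAt ℝ (fderiv ℝ (radialExt Y)) x :=
  ((contDiffAt_radialExt hY hx).fderiv_right (m := ∞) (by simp)).differentiableAt (by simp)

theorem fderiv_fderiv_radialExt_coe {Y : S2 → ℝ} (hY : IsSmooth Y) (σ : S2) :
    fderiv ℝ (fderiv ℝ (radialExt Y)) σ (σ : E3) (σ : E3) = 0 := by
  have h1 : HasDerivAt (fun r : ℝ => r • (σ : E3)) (σ : E3) 1 := by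
    simpa using (hasDerivAt_id (1 : ℝ)).smul_const (σ : E3)
  have h2 := hasDerivAt_fderiv_apply (γ := fun r : ℝ => r • (σ : E3))
    (differentiableAt_fderiv_radialExt hY (smul_ne_zero one_ne_zero (coe_ne_zero σ)))
    h1 (hasDerivAt_const 1 (σ : E3))
  have h3 : (fun r : ℝ => fderiv ℝ (radialExt Y) (r • (σ : E3)) (σ : E3))
      =ᶠ[nhds 1] fun _ => (0 : ℝ) := by
    filter_upwards [lt_mem_nhds one_pos] with r hr
    exact fderiv_radialExt_smul_coe σ hr
      (differentiableAt_radialExt hY (smul_ne_zero hr.ne' (coe_ne_zero σ)))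
  have h4 := h2.unique ((hasDerivAt_const (1 : ℝ) (0 : ℝ)).congr_of_eventuallyEq h3)
  rwa [map_zero, add_zero, one_smul] at h4

/-- Second derivative along the orbit: a Hessian term in the velocity Aσ and a gradient term in the
acceleration A²σ. -/
theorem lieDeriv_lieDeriv (A : Skew) {Y : S2 → ℝ} (hY : IsSmooth Y) (σ : S2) :
    lieDeriv A (lieDeriv A Y) σ =
      fderiv ℝ (fderiv ℝ (radialExt Y)) σ ((A : E3 →L[ℝ] E3) σ) ((A : E3 →L[ℝ] E3) σ) +
      fderiv ℝ (radialExt Y) σ ((A : E3 →L[ℝ] E3) ((A : E3 →L[ℝ] E3) σ)) := by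
  have h1 := hasDerivAt_comp_flow A (isSmooth_lieDeriv A hY) σ 0
  have hf := hasDerivAt_coe_flow A σ 0
  have h2 := hasDerivAt_fderiv_apply (γ := fun u => (flow A u σ : E3))
    (differentiableAt_fderiv_radialExt hY (coe_ne_zero _)) hf
    ((A : E3 →L[ℝ] E3).hasFDerivAt.comp_hasDerivAt (0 : ℝ) hf)
  have h := h1.unique h2
  simpa only [flow_zero, Function.comp_apply] using h

/-! ### The Laplacian as a sum of squares of rotation fields. -/

/-- The skew-adjoint operator `x ↦ ⟪u, x⟫ v - ⟪v, x⟫ u`. -/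
def skewPair {V : Type*} [NormedAddCommGroup V] [InnerProductSpace ℝ V] [CompleteSpace V]
    (u v : V) : skewAdjoint (V →L[ℝ] V) :=
  ⟨(innerSL ℝ u).smulRight v - (innerSL ℝ v).smulRight u, by
    rw [skewAdjoint.mem_iff, ContinuousLinearMap.star_eq_adjoint]
    refine ((ContinuousLinearMap.eq_adjoint_iff _ _).2 fun x y => ?_).symm
    simp only [neg_sub, sub_apply, ContinuousLinearMap.smulRight_apply,
      innerSL_apply_apply, inner_sub_left, inner_sub_right, real_inner_smul_left,
      real_inner_smul_right]
    rw [real_inner_comm x u, real_inner_comm x v]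
    ring⟩

/-- The infinitesimal rotation `x ↦ xⱼ eₖ - xₖ eⱼ`. -/
def coordRot (j k : Fin 3) : Skew :=
  skewPair (EuclideanSpace.single j (1 : ℝ)) (EuclideanSpace.single k (1 : ℝ))

theorem coordRot_apply (j k : Fin 3) (x : E3) :
    (coordRot j k : E3 →L[ℝ] E3) x =
      x j • EuclideanSpace.single k (1 : ℝ) - x k • EuclideanSpace.single j (1 : ℝ) := by
  have h (i : Fin 3) : inner ℝ (EuclideanSpace.single i (1 : ℝ)) x = x i := by
    simp [EuclideanSpace.inner_single_left]
  rw [← h j, ← h k]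
  rfl

theorem sum_coordRot_coordRot (x : E3) :
    ∑ j, ∑ k, (coordRot j k : E3 →L[ℝ] E3) ((coordRot j k : E3 →L[ℝ] E3) x) = (-4 : ℝ) • x := by
  ext i
  simp only [coordRot_apply, Fin.sum_univ_three]
  fin_cases i <;> simp <;> ring

/-- Serves twice: with B the Hessian it produces the Laplacian, and with B the square of the
differential it compares the gradient with the rotational derivatives. -/
theorem sum_bilin_coordRot (B : E3 →L[ℝ] E3 →L[ℝ] ℝ) (x : E3) :
    ∑ j, ∑ k, B ((coordRot j k : E3 →L[ℝ] E3) x) ((coordRot j k : E3 →L[ℝ] E3) x) =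
      2 * (‖x‖ ^ 2 * ∑ i, B (EuclideanSpace.single i (1 : ℝ)) (EuclideanSpace.single i (1 : ℝ))
        - B x x) := by
  have hx : x = ∑ i, x i • EuclideanSpace.single i (1 : ℝ) := by
    ext i
    fin_cases i <;> simp [Fin.sum_univ_three]
  have hB : B x x = ∑ i, ∑ j, x i * x j *
      B (EuclideanSpace.single i (1 : ℝ)) (EuclideanSpace.single j (1 : ℝ)) := by
    conv_lhs => rw [hx]
    simp only [Fin.sum_univ_three, map_add, map_smul, add_apply,
      smul_apply, smul_eq_mul]
    ring
  rw [hB, EuclideanSpace.norm_sq_eq]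
  simp only [coordRot_apply, Fin.sum_univ_three, map_sub, map_smul, Real.norm_eq_abs, sq_abs,
    sub_apply, smul_apply, smul_eq_mul]
  ring

/-- The accelerations add up to a radial vector and the radial second derivative vanishes, so only
the trace of the Hessian survives. The factor 2 appears because each plane is counted for both
orders of `j`, `k`. -/
theorem sum_lieDeriv_lieDeriv {Y : S2 → ℝ} (hY : IsSmooth Y) (σ : S2) :
    ∑ j, ∑ k, lieDeriv (coordRot j k) (lieDeriv (coordRot j k) Y) σ = 2 * sphLaplacian Y σ := by
  simp only [lieDeriv_lieDeriv _ hY, Finset.sum_add_distrib]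
  rw [sum_bilin_coordRot, fderiv_fderiv_radialExt_coe hY, norm_eq_of_mem_sphere]
  simp only [← map_sum]
  rw [sum_coordRot_coordRot, map_smul]
  rw [fderiv_radialExt_coe σ (differentiableAt_radialExt hY (coe_ne_zero σ)), sphLaplacian,
    InnerProductSpace.laplacian_eq_iteratedFDeriv_orthonormalBasis _
      (EuclideanSpace.basisFun (Fin 3) ℝ)]
  simp [iteratedFDeriv_two_apply]

/-! ### Integration by parts along rotations. -/

section Integration

theorem integrable_of_continuous {Y : S2 → ℝ} (hY : Continuous Y) : Integrable Y surfaceMeasure :=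
  hY.integrable_of_hasCompactSupport (HasCompactSupport.of_compactSpace Y)

theorem continuous_flow_right (A : Skew) (t : ℝ) : Continuous (flow A t) :=
  continuous_rotate _

theorem continuous_flow_left (A : Skew) (σ : S2) : Continuous fun t => flow A t σ :=
  (continuous_flow A).comp (continuous_id.prodMk continuous_const)

theorem integral_comp_flow (A : Skew) (t : ℝ) {Y : S2 → ℝ} (hY : Continuous Y) :
    ∫ σ, Y (flow A t σ) ∂surfaceMeasure = ∫ σ, Y σ ∂surfaceMeasure := by
  have h := measurePreserving_flow A t
  rw [← integral_map h.measurable.aemeasurable hY.aestronglyMeasurable, h.map_eq]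

theorem integral_intervalIntegral_comp_flow (A : Skew) {t : ℝ} (ht : 0 ≤ t) {Y : S2 → ℝ}
    (hY : Continuous Y) :
    ∫ σ, (∫ u in (0 : ℝ)..t, Y (flow A u σ)) ∂surfaceMeasure = t * ∫ σ, Y σ ∂surfaceMeasure := by
  simp only [intervalIntegral.integral_of_le ht]
  rw [integral_integral_swap]
  · simp only [integral_comp_flow A _ hY]
    simp [ht]
  · obtain ⟨C, hC⟩ := (isCompact_range hY).isBounded.exists_norm_le
    refine Integrable.of_bound (C := C) ?_ (Filter.Eventually.of_forall fun p => hC _ ⟨_, rfl⟩)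
    exact (hY.comp ((continuous_flow A).comp continuous_swap)).aestronglyMeasurable

theorem intervalIntegral_lieDeriv (A : Skew) {Y : S2 → ℝ} (hY : IsSmooth Y) (t : ℝ) (σ : S2) :
    ∫ u in (0 : ℝ)..t, lieDeriv A Y (flow A u σ) = Y (flow A t σ) - Y σ := by
  rw [intervalIntegral.integral_eq_sub_of_hasDerivAt (f := fun u => Y (flow A u σ))
    (fun u _ => hasDerivAt_comp_flow A hY σ u)
    (((isSmooth_lieDeriv A hY).continuous.comp (continuous_flow_left A σ)).intervalIntegrable _ _)]
  simp

theorem integral_lieDeriv (A : Skew) {Y : S2 → ℝ} (hY : IsSmooth Y) :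
    ∫ σ, lieDeriv A Y σ ∂surfaceMeasure = 0 := by
  have h := integral_intervalIntegral_comp_flow A zero_le_one (isSmooth_lieDeriv A hY).continuous
  rw [one_mul] at h
  rw [← h]
  simp only [intervalIntegral_lieDeriv A hY]
  have hi : Integrable (fun σ => Y (flow A 1 σ)) surfaceMeasure :=
    integrable_of_continuous (hY.continuous.comp (continuous_flow_right A 1))
  rw [integral_sub hi (integrable_of_continuous hY.continuous),
    integral_comp_flow A 1 hY.continuous, sub_self]

theorem integral_lieDeriv_mul (A : Skew) {Y Z : S2 → ℝ} (hY : IsSmooth Y) (hZ : IsSmooth Z) :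
    ∫ σ, lieDeriv A Y σ * Z σ ∂surfaceMeasure = -∫ σ, Y σ * lieDeriv A Z σ ∂surfaceMeasure := by
  have h := integral_lieDeriv A (hY.mul hZ)
  rw [lieDeriv_mul A hY hZ] at h
  simp only [Pi.add_apply, Pi.mul_apply] at h
  rw [integral_add] at h
  · linarith
  · exact integrable_of_continuous ((isSmooth_lieDeriv A hY).continuous.mul hZ.continuous)
  · exact integrable_of_continuous (hY.continuous.mul (isSmooth_lieDeriv A hZ).continuous)

theorem integral_sphLaplacian_mul {Y Z : S2 → ℝ} (hY : IsSmooth Y) (hZ : IsSmooth Z) :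
    2 * ∫ σ, sphLaplacian Y σ * Z σ ∂surfaceMeasure =
      -∑ j, ∑ k, ∫ σ, lieDeriv (coordRot j k) Y σ * lieDeriv (coordRot j k) Z σ
        ∂surfaceMeasure := by
  rw [← integral_const_mul]
  simp only [← mul_assoc, ← sum_lieDeriv_lieDeriv hY, Finset.sum_mul]
  have hc (j k : Fin 3) : Integrable
      (fun σ => lieDeriv (coordRot j k) (lieDeriv (coordRot j k) Y) σ * Z σ) surfaceMeasure :=
    integrable_of_continuous
      ((isSmooth_lieDeriv _ (isSmooth_lieDeriv _ hY)).continuous.mul hZ.continuous)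
  rw [integral_finsetSum _ fun j _ => integrable_finsetSum _ fun k _ => hc j k,
    ← Finset.sum_neg_distrib]
  refine Finset.sum_congr rfl fun j _ => ?_
  rw [integral_finsetSum _ fun k _ => hc j k, ← Finset.sum_neg_distrib]
  exact Finset.sum_congr rfl fun k _ => integral_lieDeriv_mul _ (isSmooth_lieDeriv _ hY) hZ

theorem integral_sphLaplacian_mul_comm {Y Z : S2 → ℝ} (hY : IsSmooth Y) (hZ : IsSmooth Z) :
    ∫ σ, sphLaplacian Y σ * Z σ ∂surfaceMeasure = ∫ σ, Y σ * sphLaplacian Z σ ∂surfaceMeasure := by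
  have h1 := integral_sphLaplacian_mul hY hZ
  have h2 := integral_sphLaplacian_mul hZ hY
  simp only [mul_comm (lieDeriv _ Z _)] at h2
  simp only [mul_comm (Y _)]
  linarith

/-- The right-hand side is the sum over all nine rotations of such integrals; one nonnegative term
is kept. -/
theorem integral_lieDeriv_sq_le {Y : S2 → ℝ} (hY : IsSmooth Y) (j k : Fin 3) :
    ∫ σ, lieDeriv (coordRot j k) Y σ ^ 2 ∂surfaceMeasure ≤
      -(2 * ∫ σ, sphLaplacian Y σ * Y σ ∂surfaceMeasure) := by
  have h := integral_sphLaplacian_mul hY hY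
  simp only [← sq] at h
  rw [h, neg_neg]
  have hn (j k : Fin 3) : 0 ≤ ∫ σ, lieDeriv (coordRot j k) Y σ ^ 2 ∂surfaceMeasure :=
    integral_nonneg fun σ => sq_nonneg _
  refine (Finset.single_le_sum (f := fun k => ∫ σ, lieDeriv (coordRot j k) Y σ ^ 2 ∂surfaceMeasure)
    (fun k _ => hn j k) (Finset.mem_univ k)).trans ?_
  exact Finset.single_le_sum
    (f := fun j => ∑ k, ∫ σ, lieDeriv (coordRot j k) Y σ ^ 2 ∂surfaceMeasure)
    (fun j _ => Finset.sum_nonneg fun k _ => hn j k) (Finset.mem_univ j)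

/-- Cauchy–Schwarz, from the nonnegativity of the variance of `k` on the interval. -/
theorem sq_intervalIntegral_le {k : ℝ → ℝ} (hk : Continuous k) {t : ℝ} (ht : 0 < t) :
    (∫ u in (0 : ℝ)..t, k u) ^ 2 ≤ t * ∫ u in (0 : ℝ)..t, k u ^ 2 := by
  set I := ∫ u in (0 : ℝ)..t, k u with hI
  have h : 0 ≤ ∫ u in (0 : ℝ)..t, (t * k u - I) ^ 2 :=
    intervalIntegral.integral_nonneg ht.le fun u _ => sq_nonneg _
  have e : ∫ u in (0 : ℝ)..t, (t * k u - I) ^ 2 =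
      t ^ 2 * (∫ u in (0 : ℝ)..t, k u ^ 2) - t * I ^ 2 := by
    have : ∀ u, (t * k u - I) ^ 2 = t ^ 2 * k u ^ 2 - 2 * t * I * k u + I ^ 2 := fun u => by ring
    simp only [this]
    rw [intervalIntegral.integral_add, intervalIntegral.integral_sub,
      intervalIntegral.integral_const_mul, intervalIntegral.integral_const_mul, ← hI]
    · simp; ring
    all_goals exact Continuous.intervalIntegrable (by fun_prop) _ _
  rw [e] at h
  have : 0 ≤ t * (t * (∫ u in (0 : ℝ)..t, k u ^ 2) - I ^ 2) := by linarith
  linarith [nonneg_of_mul_nonneg_right this ht]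

theorem integral_sub_comp_flow_sq_le (A : Skew) {Y : S2 → ℝ} (hY : IsSmooth Y) {t : ℝ}
    (ht : 0 < t) :
    ∫ σ, (Y (flow A t σ) - Y σ) ^ 2 ∂surfaceMeasure ≤
      t ^ 2 * ∫ σ, lieDeriv A Y σ ^ 2 ∂surfaceMeasure := by
  have hL := (isSmooth_lieDeriv A hY).continuous
  have e := integral_intervalIntegral_comp_flow A ht.le (hL.pow 2)
  simp only [Pi.pow_apply] at e
  rw [sq t, mul_assoc, ← e, ← integral_const_mul]
  refine integral_mono ?_ ?_ fun σ => ?_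
  · refine integrable_of_continuous ?_
    have := hY.continuous
    have := continuous_flow_right A t
    fun_prop
  · refine (integrable_of_continuous ?_)
    refine continuous_const.mul (intervalIntegral.continuous_parametric_intervalIntegral_of_continuous' ?_ _ _)
    exact (hL.comp ((continuous_flow A).comp continuous_swap)).pow 2
  · simp only [← intervalIntegral_lieDeriv A hY]
    exact sq_intervalIntegral_le (hL.comp (continuous_flow_left A σ)) ht

end Integration

/-! ### Eigenspaces, their orthogonality and the action of rotations on them. -/

section Eigenfunctions

/-- The trace of the Hessian may be taken in any orthonormal basis, in particular in the image under
`R` of the standard one. -/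
theorem laplacian_comp_linearIsometryEquiv {V : Type*} [NormedAddCommGroup V]
    [InnerProductSpace ℝ V] [FiniteDimensional ℝ V] (R : V ≃ₗᵢ[ℝ] V) (F : V → ℝ) (x : V) :
    Δ (F ∘ R) x = Δ F (R x) := by
  rw [InnerProductSpace.laplacian_eq_iteratedFDeriv_orthonormalBasis F
      ((stdOrthonormalBasis ℝ V).map R),
    InnerProductSpace.laplacian_eq_iteratedFDeriv_orthonormalBasis _ (stdOrthonormalBasis ℝ V)]
  refine Finset.sum_congr rfl fun i _ => ?_
  have h := R.toContinuousLinearEquiv.iteratedFDerivWithin_comp_right F uniqueDiffOn_univ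
    (Set.mem_univ (R.toContinuousLinearEquiv x)) 2
  simp only [Set.preimage_univ, iteratedFDerivWithin_univ] at h
  have h' := congrArg (fun m => m ![stdOrthonormalBasis ℝ V i, stdOrthonormalBasis ℝ V i]) h
  refine h'.trans ?_
  simp only [ContinuousMultilinearMap.compContinuousLinearMap_apply]
  congr 1
  ext a
  fin_cases a <;> rfl

theorem radialExt_comp_rotate (R : E3 ≃ₗᵢ[ℝ] E3) (Y : S2 → ℝ) {x : E3} (hx : x ≠ 0) :
    radialExt (Y ∘ rotate R) x = radialExt Y (R x) := by
  have hRx : R x ≠ 0 := by simpa using hx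
  simp only [radialExt, Function.comp_apply]
  congr 1
  ext1
  rw [coe_rotate, coe_radialProj hx, coe_radialProj hRx, map_smul, R.norm_map]

theorem isSmooth_comp_rotate (R : E3 ≃ₗᵢ[ℝ] E3) {Y : S2 → ℝ} (hY : IsSmooth Y) :
    IsSmooth (Y ∘ rotate R) := by
  have h := isSmooth_of_contDiffAt (F := radialExt Y ∘ R) fun σ =>
    (contDiffAt_radialExt hY (coe_ne_zero (rotate R σ))).comp (σ : E3) R.contDiff.contDiffAt
  convert h using 2 with σ
  simp [← coe_rotate]

theorem sphLaplacian_comp_rotate (R : E3 ≃ₗᵢ[ℝ] E3) (Y : S2 → ℝ) (σ : S2) :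
    sphLaplacian (Y ∘ rotate R) σ = sphLaplacian Y (rotate R σ) := by
  rw [sphLaplacian, sphLaplacian, coe_rotate, ← laplacian_comp_linearIsometryEquiv]
  refine (InnerProductSpace.laplacian_congr_nhds ?_).eq_of_nhds
  filter_upwards [isOpen_compl_singleton.mem_nhds (coe_ne_zero σ)] with x hx
  exact radialExt_comp_rotate R Y hx

/-- Continuous functions as elements of `L²(𝕊²)`. -/
def toL2 (Y : S2 → ℝ) (hY : Continuous Y) : L2 := ContinuousMap.toLp 2 surfaceMeasure ℝ ⟨Y, hY⟩

theorem coeFn_toL2 {Y : S2 → ℝ} (hY : Continuous Y) : toL2 Y hY =ᵐ[surfaceMeasure] Y :=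
  ContinuousMap.coeFn_toLp _ _

theorem inner_toL2 {Y Z : S2 → ℝ} (hY : Continuous Y) (hZ : Continuous Z) :
    inner ℝ (toL2 Y hY) (toL2 Z hZ) = ∫ σ, Y σ * Z σ ∂surfaceMeasure := by
  rw [toL2, toL2, ContinuousMap.inner_toLp]
  simp [mul_comm]

theorem norm_toL2_sq {Y : S2 → ℝ} (hY : Continuous Y) :
    ‖toL2 Y hY‖ ^ 2 = ∫ σ, Y σ ^ 2 ∂surfaceMeasure := by
  rw [← real_inner_self_eq_norm_sq, inner_toL2]
  simp only [sq]

theorem eq_toL2 {Y : S2 → ℝ} (hY : Continuous Y) {u : L2} (hu : u =ᵐ[surfaceMeasure] Y) :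
    u = toL2 Y hY :=
  Lp.ext (hu.trans (coeFn_toL2 hY).symm)

/-- The rotations of the flow of `A` acting on `L²(𝕊²)`. -/
def flowL2 (A : Skew) (t : ℝ) : L2 →ₗᵢ[ℝ] L2 :=
  Lp.compMeasurePreservingₗᵢ ℝ (flow A t) (measurePreserving_flow A t)

theorem flowL2_toL2 (A : Skew) (t : ℝ) {Y : S2 → ℝ} (hY : Continuous Y) :
    flowL2 A t (toL2 Y hY) = toL2 (Y ∘ flow A t) (hY.comp (continuous_flow_right A t)) := by
  refine eq_toL2 _ ?_
  refine (Lp.coeFn_compMeasurePreserving _ (measurePreserving_flow A t)).trans ?_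
  exact (measurePreserving_flow A t).quasiMeasurePreserving.ae_eq_comp (coeFn_toL2 hY)

theorem toL2_sub {Y Z : S2 → ℝ} (hY : Continuous Y) (hZ : Continuous Z) :
    toL2 Y hY - toL2 Z hZ = toL2 (Y - Z) (hY.sub hZ) :=
  (map_sub (ContinuousMap.toLp 2 surfaceMeasure ℝ) ⟨Y, hY⟩ ⟨Z, hZ⟩).symm

theorem sphLaplacian_add {Y Z : S2 → ℝ} (hY : IsSmooth Y) (hZ : IsSmooth Z) (σ : S2) :
    sphLaplacian (Y + Z) σ = sphLaplacian Y σ + sphLaplacian Z σ :=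
  ContDiffAt.laplacian_add (contDiffAt_infty.1 (contDiffAt_radialExt hY (coe_ne_zero σ)) 2)
    (contDiffAt_infty.1 (contDiffAt_radialExt hZ (coe_ne_zero σ)) 2)

theorem sphLaplacian_const_smul (c : ℝ) {Y : S2 → ℝ} (hY : IsSmooth Y) (σ : S2) :
    sphLaplacian (c • Y) σ = c * sphLaplacian Y σ :=
  InnerProductSpace.laplacian_smul c
    (contDiffAt_infty.1 (contDiffAt_radialExt hY (coe_ne_zero σ)) 2)

theorem isSmooth_const (c : ℝ) : IsSmooth fun _ => c := contMDiff_const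

theorem isSmooth_const_smul (c : ℝ) {Y : S2 → ℝ} (hY : IsSmooth Y) : IsSmooth (c • Y) :=
  (isSmooth_const c).mul hY

/-- The linear space of smooth eigenfunctions of `-Δ_σ` for the value `lam`. -/
def eigenfunctions (lam : ℝ≥0) : Submodule ℝ L2 where
  carrier := {u : L2 | ∃ Y : S2 → ℝ, IsSmooth Y ∧
    (∀ σ, -sphLaplacian Y σ = lam * Y σ) ∧ u =ᵐ[surfaceMeasure] Y}
  zero_mem' := by
    refine ⟨0, isSmooth_const 0, fun σ => ?_, Lp.coeFn_zero _ _ _⟩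
    have : radialExt 0 = fun _ => 0 := rfl
    rw [sphLaplacian, this, InnerProductSpace.laplacian_const]
    simp
  add_mem' := by
    rintro u v ⟨Y, hY, hYe, hu⟩ ⟨Z, hZ, hZe, hv⟩
    refine ⟨Y + Z, hY.add hZ, fun σ => ?_, (Lp.coeFn_add u v).trans (hu.add hv)⟩
    rw [sphLaplacian_add hY hZ, Pi.add_apply]
    linear_combination hYe σ + hZe σ
  smul_mem' := by
    rintro c u ⟨Y, hY, hYe, hu⟩
    refine ⟨c • Y, isSmooth_const_smul c hY, fun σ => ?_,
      (Lp.coeFn_smul c u).trans (hu.const_smul c)⟩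
    rw [sphLaplacian_const_smul c hY, Pi.smul_apply, smul_eq_mul]
    linear_combination c * hYe σ

theorem eigenspace_eq (lam : ℝ≥0) :
    eigenspace lam = (eigenfunctions lam).topologicalClosure := by
  conv_rhs => rw [← Submodule.span_eq (eigenfunctions lam)]
  rfl

/-- Symmetry of the Laplacian makes smooth eigenfunctions orthogonal; orthogonality then passes to
the two closures, one at a time. -/
theorem isOrtho_eigenspace {lam mu : ℝ≥0} (h : lam ≠ mu) :
    (eigenspace lam).IsOrtho (eigenspace mu) := by
  have key : (eigenfunctions lam).IsOrtho (eigenfunctions mu) := by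
    rw [Submodule.isOrtho_iff_inner_eq]
    rintro u ⟨Y, hY, hYe, hu⟩ v ⟨Z, hZ, hZe, hv⟩
    rw [eq_toL2 hY.continuous hu, eq_toL2 hZ.continuous hv, inner_toL2]
    have e := integral_sphLaplacian_mul_comm hY hZ
    have h1 : ∀ σ, sphLaplacian Y σ * Z σ = -(lam : ℝ) * (Y σ * Z σ) := fun σ => by
      linear_combination -(Z σ) * hYe σ
    have h2 : ∀ σ, Y σ * sphLaplacian Z σ = -(mu : ℝ) * (Y σ * Z σ) := fun σ => by
      linear_combination -(Y σ) * hZe σ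
    simp only [h1, h2, integral_const_mul] at e
    have hne : (lam : ℝ) - mu ≠ 0 := sub_ne_zero.2 (by exact_mod_cast h)
    have : ((lam : ℝ) - mu) * ∫ σ, Y σ * Z σ ∂surfaceMeasure = 0 := by linarith
    exact (mul_eq_zero.1 this).resolve_left hne
  rw [eigenspace_eq, eigenspace_eq]
  have h1 : (eigenfunctions lam).topologicalClosure ≤ (eigenfunctions mu)ᗮ :=
    Submodule.topologicalClosure_minimal _ key (Submodule.isClosed_orthogonal _)
  have h2 : (eigenfunctions mu).topologicalClosure ≤ (eigenfunctions lam).topologicalClosureᗮ :=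
    Submodule.topologicalClosure_minimal _ (Submodule.IsOrtho.symm h1)
      (Submodule.isClosed_orthogonal _)
  exact Submodule.IsOrtho.symm h2

theorem flowL2_mem_eigenspace (A : Skew) (t : ℝ) {lam : ℝ≥0} {u : L2} (hu : u ∈ eigenspace lam) :
    flowL2 A t u ∈ eigenspace lam := by
  rw [eigenspace_eq] at *
  have h : (eigenfunctions lam).topologicalClosure ≤
      (eigenfunctions lam).topologicalClosure.comap (flowL2 A t).toLinearMap := by
    refine Submodule.topologicalClosure_minimal _ ?_
      ((Submodule.isClosed_topologicalClosure _).preimage (flowL2 A t).continuous)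
    rintro u ⟨Y, hY, hYe, hu⟩
    refine Submodule.le_topologicalClosure _ ⟨Y ∘ flow A t, isSmooth_comp_rotate _ hY,
      fun σ => ?_, ?_⟩
    · rw [flow, sphLaplacian_comp_rotate]
      exact hYe _
    · rw [eq_toL2 hY.continuous hu]
      have h := flowL2_toL2 A t hY.continuous
      change flowL2 A t _ =ᵐ[surfaceMeasure] _
      rw [h]
      exact coeFn_toL2 _
  exact h hu

/-- For a smooth eigenfunction the increment is the time integral of the derivative along the flow,
whose squared norm is at most 2λ‖u‖². The estimate is a closed condition on `u`. -/
theorem norm_flowL2_sub_sq_le (j k : Fin 3) {t : ℝ} (ht : 0 < t) {lam : ℝ≥0} {u : L2}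
    (hu : u ∈ eigenspace lam) :
    ‖flowL2 (coordRot j k) t u - u‖ ^ 2 ≤ 2 * lam * t ^ 2 * ‖u‖ ^ 2 := by
  rw [eigenspace_eq] at hu
  have hcl : IsClosed {u : L2 |
      ‖flowL2 (coordRot j k) t u - u‖ ^ 2 ≤ 2 * lam * t ^ 2 * ‖u‖ ^ 2} := by
    have := (flowL2 (coordRot j k) t).continuous
    exact isClosed_le (by fun_prop) (by fun_prop)
  refine closure_minimal ?_ hcl hu
  rintro u ⟨Y, hY, hYe, hu⟩
  rw [Set.mem_ofPred_eq, eq_toL2 hY.continuous hu, flowL2_toL2, toL2_sub, norm_toL2_sq,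
    norm_toL2_sq]
  refine (integral_sub_comp_flow_sq_le (coordRot j k) hY ht).trans ?_
  have h1 := integral_lieDeriv_sq_le hY j k
  have h2 : ∀ σ, sphLaplacian Y σ * Y σ = -(lam : ℝ) * Y σ ^ 2 := fun σ => by
    linear_combination -(Y σ) * hYe σ
  simp only [h2, integral_const_mul] at h1
  nlinarith [sq_nonneg t]

end Eigenfunctions

/-! ### Two facts on orthogonal decompositions. -/

section Hilbert

variable {H : Type*} [NormedAddCommGroup H] [InnerProductSpace ℝ H]

/-- The finite-dimensional spectral theorem for `T`, with the inner product pulled back from `H`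
along `f`: eigenvectors span. -/
theorem mem_of_forall_eigenvector_mem {V : Type*} [AddCommGroup V] [Module ℝ V]
    [FiniteDimensional ℝ V] {f : V →ₗ[ℝ] H} (hf : Function.Injective f) {T : V →ₗ[ℝ] V}
    (hT : ∀ x y, inner ℝ (f (T x)) (f y) = inner ℝ (f x) (f (T y))) {S : Submodule ℝ H}
    (hS : ∀ (μ : ℝ) (v : V), T v = μ • v → f v ∈ S) (x : V) : f x ∈ S := by
  let e : V ≃ₗ[ℝ] LinearMap.range f := LinearEquiv.ofInjective f hf
  have he (v : V) : ((e v : LinearMap.range f) : H) = f v := rfl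
  let T' : LinearMap.range f →ₗ[ℝ] LinearMap.range f := e.conj T
  have hT' : T'.IsSymmetric := by
    intro a b
    obtain ⟨a, rfl⟩ := e.surjective a
    obtain ⟨b, rfl⟩ := e.surjective b
    simpa [T', LinearEquiv.conj_apply, Submodule.coe_inner, he] using! hT a b
  have htop : ⨆ μ, Module.End.eigenspace T' μ = ⊤ :=
    Submodule.orthogonal_eq_bot_iff.1 hT'.orthogonalComplement_iSup_eigenspaces_eq_bot
  have hle : ⨆ μ, Module.End.eigenspace T' μ ≤ S.comap (LinearMap.range f).subtype := by
    refine iSup_le fun μ a ha => ?_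
    obtain ⟨a, rfl⟩ := e.surjective a
    refine hS μ a (e.injective ?_)
    simpa [T', LinearEquiv.conj_apply] using Module.End.mem_eigenspace_iff.1 ha
  rw [htop] at hle
  exact hle (Submodule.mem_top : e x ∈ ⊤)

variable [CompleteSpace H]

/-- As `T` maps each summand into itself, the images of the components of `x` remain mutually
orthogonal, and Pythagoras applies. -/
theorem hasSum_norm_sq_starProjection {ι : Type*} {K : ι → Submodule ℝ H}
    [∀ i, CompleteSpace (K i)] (hK : OrthogonalFamily ℝ (fun i => K i) fun i => (K i).subtypeₗᵢ)
    (hdense : (⨆ i, K i).topologicalClosure = ⊤) (T : H →L[ℝ] H)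
    (hT : ∀ i, ∀ x ∈ K i, T x ∈ K i) (x : H) :
    HasSum (fun i => ‖T ((K i).starProjection x)‖ ^ 2) (‖T x‖ ^ 2) := by
  have hS := IsHilbertSum.mkInternal K hK hdense.ge
  have hsum : HasSum (fun i => ((hS.linearIsometryEquiv x i : K i) : H)) x := by
    have := hS.hasSum_linearIsometryEquiv_symm (hS.linearIsometryEquiv x)
    simpa using! this
  have hproj (i : ι) : (K i).starProjection x = hS.linearIsometryEquiv x i := by
    classical
    have h1 := hsum.mapL (K i).starProjection
    refine h1.unique ?_
    convert! hasSum_ite_eq i ((hS.linearIsometryEquiv x i : K i) : H) using 2 with j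
    split_ifs with hij
    · subst hij
      exact Submodule.starProjection_eq_self_iff.2 (Subtype.coe_prop _)
    · rw [Submodule.starProjection_apply,
        Submodule.orthogonalProjectionOnto_apply_of_mem_orthogonal, Submodule.coe_zero]
      exact hK.isOrtho hij (Subtype.coe_prop _)
  have h2 := hsum.mapL T
  have h3 : HasSum (fun i => ‖T (hS.linearIsometryEquiv x i : K i)‖ ^ 2) (‖T x‖ ^ 2) := by
    refine Filter.Tendsto.congr (fun s => ?_) ((continuous_norm.pow 2).tendsto _ |>.comp h2)
    exact hK.norm_sum (fun i => ⟨_, hT i _ (hS.linearIsometryEquiv x i).2⟩) s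
  simpa only [hproj] using h3

end Hilbert

/-! ### Density of the eigenspaces, by polynomials. -/

section Polynomials

theorem lieDeriv_eq_of_hasDerivAt {A : Skew} {Y : S2 → ℝ} (hY : IsSmooth Y) {σ : S2} {d : ℝ}
    (h : HasDerivAt (fun u => Y (flow A u σ)) d 0) : lieDeriv A Y σ = d := by
  simpa using (hasDerivAt_comp_flow A hY σ 0).unique h

theorem lieDeriv_add (A : Skew) {Y Z : S2 → ℝ} (hY : IsSmooth Y) (hZ : IsSmooth Z) (σ : S2) :
    lieDeriv A (Y + Z) σ = lieDeriv A Y σ + lieDeriv A Z σ := by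
  refine lieDeriv_eq_of_hasDerivAt (hY.add hZ) ?_
  simpa using! (hasDerivAt_comp_flow A hY σ 0).add (hasDerivAt_comp_flow A hZ σ 0)

theorem lieDeriv_const_smul (A : Skew) (c : ℝ) {Y : S2 → ℝ} (hY : IsSmooth Y) (σ : S2) :
    lieDeriv A (c • Y) σ = c * lieDeriv A Y σ := by
  refine lieDeriv_eq_of_hasDerivAt (isSmooth_const_smul c hY) ?_
  simpa using! (hasDerivAt_comp_flow A hY σ 0).const_mul c

theorem lieDeriv_const (A : Skew) (c : ℝ) (σ : S2) : lieDeriv A (fun _ => c) σ = 0 :=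
  lieDeriv_eq_of_hasDerivAt (isSmooth_const c) (hasDerivAt_const _ _)

/-- The coordinate functions on the sphere. -/
def coord (i : Fin 3) : C(S2, ℝ) := ⟨fun σ => (σ : E3) i, by fun_prop⟩

theorem isSmooth_coord (i : Fin 3) : IsSmooth (coord i) :=
  isSmooth_of_contDiffAt (F := fun x : E3 => x i) fun _ =>
    (EuclideanSpace.proj (𝕜 := ℝ) i).contDiff.contDiffAt

theorem lieDeriv_coord (A : Skew) (i : Fin 3) (σ : S2) :
    lieDeriv A (coord i) σ = (A : E3 →L[ℝ] E3) σ i := by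
  refine lieDeriv_eq_of_hasDerivAt (isSmooth_coord i) ?_
  have h := hasDerivAt_coe_flow A σ 0
  rw [flow_zero] at h
  exact (EuclideanSpace.proj (𝕜 := ℝ) i).hasFDerivAt.comp_hasDerivAt (0 : ℝ) h

/-- The restrictions to the sphere of polynomials of degree at most one. -/
def affineFunctions : Submodule ℝ C(S2, ℝ) := Submodule.span ℝ (insert 1 (Set.range coord))

theorem one_mem_affineFunctions : (1 : C(S2, ℝ)) ∈ affineFunctions :=
  Submodule.subset_span (Set.mem_insert _ _)

theorem coord_mem_affineFunctions (i : Fin 3) : coord i ∈ affineFunctions :=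
  Submodule.subset_span (Set.mem_insert_of_mem _ ⟨i, rfl⟩)

/-- The smooth functions all of whose derivatives along rotations belong to `P`. -/
def smoothLieInto (P : Submodule ℝ C(S2, ℝ)) : Submodule ℝ C(S2, ℝ) where
  carrier := {f | IsSmooth f ∧ ∀ A : Skew, ∃ f' ∈ P, ∀ σ, lieDeriv A f σ = f' σ}
  zero_mem' := ⟨isSmooth_const 0, fun A => ⟨0, P.zero_mem, lieDeriv_const A 0⟩⟩
  add_mem' := by
    rintro f g ⟨hf, hf'⟩ ⟨hg, hg'⟩
    refine ⟨hf.add hg, fun A => ?_⟩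
    obtain ⟨a, ha, ha'⟩ := hf' A
    obtain ⟨b, hb, hb'⟩ := hg' A
    refine ⟨a + b, P.add_mem ha hb, fun σ => ?_⟩
    rw [ContinuousMap.coe_add, lieDeriv_add A hf hg, ha', hb']
    rfl
  smul_mem' := by
    rintro c f ⟨hf, hf'⟩
    refine ⟨isSmooth_const_smul c hf, fun A => ?_⟩
    obtain ⟨a, ha, ha'⟩ := hf' A
    refine ⟨c • a, P.smul_mem c ha, fun σ => ?_⟩
    rw [ContinuousMap.coe_smul, lieDeriv_const_smul A c hf, ha']
    rfl

theorem affineFunctions_le : affineFunctions ≤ smoothLieInto affineFunctions := by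
  refine Submodule.span_le.2 ?_
  rintro f (rfl | ⟨i, rfl⟩)
  · exact ⟨isSmooth_const 1, fun A => ⟨0, Submodule.zero_mem _, lieDeriv_const A 1⟩⟩
  · refine ⟨isSmooth_coord i, fun A => ⟨∑ j, (A : E3 →L[ℝ] E3) (EuclideanSpace.single j 1) i •
      coord j, Submodule.sum_mem _ fun j _ => Submodule.smul_mem _ _
        (coord_mem_affineFunctions j), fun σ => ?_⟩⟩
    have hx : (σ : E3) = ∑ j, (σ : E3) j • EuclideanSpace.single j (1 : ℝ) := by
      ext i
      fin_cases i <;> simp [Fin.sum_univ_three]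
    rw [lieDeriv_coord]
    conv_lhs => rw [hx]
    simp [Fin.sum_univ_three, coord, mul_comm]

/-- Rotations act linearly on coordinates, so differentiating along them keeps affine functions
affine; the Leibniz rule extends this to products. Polynomials of degree at most `N` thus form a
finite-dimensional space stable under the Laplacian. -/
theorem pow_affineFunctions_le (N : ℕ) :
    affineFunctions ^ N ≤ smoothLieInto (affineFunctions ^ N) := by
  induction N with
  | zero =>
    rw [pow_zero, Submodule.one_le]
    exact ⟨isSmooth_const 1, fun A => ⟨0, Submodule.zero_mem _, lieDeriv_const A 1⟩⟩
  | succ N ih =>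
    conv_lhs => rw [pow_succ]
    rw [Submodule.mul_le]
    intro f hf g hg
    obtain ⟨hfs, hf'⟩ := ih hf
    obtain ⟨hgs, hg'⟩ := affineFunctions_le hg
    refine ⟨hfs.mul hgs, fun A => ?_⟩
    obtain ⟨a, ha, ha'⟩ := hf' A
    obtain ⟨b, hb, hb'⟩ := hg' A
    refine ⟨a * g + f * b, ?_, fun σ => ?_⟩
    · rw [pow_succ]
      exact Submodule.add_mem _ (Submodule.mul_mem_mul ha hg) (Submodule.mul_mem_mul hf hb)
    · rw [ContinuousMap.coe_mul, lieDeriv_mul A hfs hgs]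
      simp [ha', hb']

theorem isSmooth_of_mem_pow {N : ℕ} {f : C(S2, ℝ)} (hf : f ∈ affineFunctions ^ N) : IsSmooth f :=
  (pow_affineFunctions_le N hf).1

theorem exists_sphLaplacian_eq {N : ℕ} {f : C(S2, ℝ)} (hf : f ∈ affineFunctions ^ N) :
    ∃ f' ∈ affineFunctions ^ N, ∀ σ, f' σ = -sphLaplacian f σ := by
  have h (j k : Fin 3) : ∃ f' ∈ affineFunctions ^ N,
      ∀ σ, lieDeriv (coordRot j k) (lieDeriv (coordRot j k) f) σ = f' σ := by
    obtain ⟨a, ha, ha'⟩ := (pow_affineFunctions_le N hf).2 (coordRot j k)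
    obtain ⟨b, hb, hb'⟩ := (pow_affineFunctions_le N ha).2 (coordRot j k)
    refine ⟨b, hb, fun σ => ?_⟩
    rw [funext ha', hb']
  choose f' hf' hf'' using h
  refine ⟨(-1 / 2 : ℝ) • ∑ j, ∑ k, f' j k, Submodule.smul_mem _ _ (Submodule.sum_mem _ fun j _ =>
    Submodule.sum_mem _ fun k _ => hf' j k), fun σ => ?_⟩
  have := sum_lieDeriv_lieDeriv (isSmooth_of_mem_pow hf) σ
  simp only [hf''] at this
  rw [ContinuousMap.smul_apply, ContinuousMap.sum_apply]
  simp only [ContinuousMap.sum_apply]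
  rw [this, smul_eq_mul]
  ring

theorem toLp_mem_iSup_eigenspace {N : ℕ} {f : C(S2, ℝ)} (hf : f ∈ affineFunctions ^ N) :
    ContinuousMap.toLp 2 surfaceMeasure ℝ f ∈ ⨆ lam, eigenspace lam := by
  have hfin : FiniteDimensional ℝ ↥(affineFunctions ^ N) := by
    refine Module.Finite.of_fg (Submodule.FG.pow ?_ N)
    exact Submodule.fg_span ((Set.finite_range coord).insert 1)
  choose D hD hD' using fun v : ↥(affineFunctions ^ N) => exists_sphLaplacian_eq v.2
  let T : ↥(affineFunctions ^ N) →ₗ[ℝ] ↥(affineFunctions ^ N) :=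
    { toFun := fun v => ⟨D v, hD v⟩
      map_add' := fun v w => by
        ext σ
        simp only [Submodule.coe_add, ContinuousMap.add_apply, hD', ContinuousMap.coe_add]
        rw [sphLaplacian_add (isSmooth_of_mem_pow v.2) (isSmooth_of_mem_pow w.2)]
        ring
      map_smul' := fun c v => by
        ext σ
        simp only [Submodule.coe_smul, ContinuousMap.smul_apply, hD', ContinuousMap.coe_smul,
          RingHom.id_apply, smul_eq_mul]
        rw [sphLaplacian_const_smul c (isSmooth_of_mem_pow v.2)]
        ring }
  let ι : ↥(affineFunctions ^ N) →ₗ[ℝ] L2 :=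
    (ContinuousMap.toLp 2 surfaceMeasure ℝ).toLinearMap ∘ₗ (affineFunctions ^ N).subtype
  refine mem_of_forall_eigenvector_mem (f := ι) (T := T) ?_ ?_ ?_ ⟨f, hf⟩
  · exact (ContinuousMap.toLp_injective surfaceMeasure).comp Subtype.val_injective
  · intro v w
    have e := integral_sphLaplacian_mul_comm (isSmooth_of_mem_pow v.2) (isSmooth_of_mem_pow w.2)
    refine (inner_toL2 (map_continuous (D v)) (map_continuous w.1)).trans ?_
    refine Eq.trans ?_ (inner_toL2 (map_continuous v.1) (map_continuous (D w))).symm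
    simp only [hD', neg_mul, mul_neg, integral_neg, e]
  · intro μ v hv
    by_cases hv0 : v = 0
    · rw [hv0, map_zero]
      exact Submodule.zero_mem _
    have hs := isSmooth_of_mem_pow v.2
    have heig (σ : S2) : -sphLaplacian v.1 σ = μ * v.1 σ := by
      rw [← hD']
      exact congrArg (fun w : ↥(affineFunctions ^ N) => w.1 σ) hv
    -- Eigenspaces are indexed by nonnegative reals. Any pair of indices will do: the energy bound
    -- only has to show that the Dirichlet form of `v` is nonnegative.
    have hμ : 0 ≤ μ := by
      have h1 := (integral_nonneg fun σ => sq_nonneg _).trans (integral_lieDeriv_sq_le hs 0 0)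
      have h2 : ∀ σ, sphLaplacian v.1 σ * v.1 σ = -μ * v.1 σ ^ 2 := fun σ => by
        linear_combination -(v.1 σ) * heig σ
      simp only [h2, integral_const_mul] at h1
      rw [← norm_toL2_sq (map_continuous v.1)] at h1
      have hpos : 0 < ‖toL2 v.1 (map_continuous v.1)‖ := by
        rw [norm_pos_iff]
        intro h0
        apply hv0
        apply Subtype.ext
        apply ContinuousMap.toLp_injective (p := 2) (𝕜 := ℝ) surfaceMeasure
        rw [Submodule.coe_zero, map_zero]
        exact h0
      have : 0 ≤ μ * ‖toL2 v.1 (map_continuous v.1)‖ ^ 2 := by linarith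
      exact nonneg_of_mul_nonneg_left this (by positivity)
    lift μ to ℝ≥0 using hμ
    refine Submodule.mem_iSup_of_mem μ ?_
    rw [eigenspace_eq]
    exact Submodule.le_topologicalClosure _ ⟨v.1, hs, heig, ContinuousMap.coeFn_toLp _ _⟩

theorem exists_mem_pow_of_mem_adjoin {f : C(S2, ℝ)} (hf : f ∈ Algebra.adjoin ℝ (Set.range coord)) :
    ∃ N : ℕ, f ∈ affineFunctions ^ N := by
  -- Constants are affine, so the powers increase with the exponent and sums of different degrees
  -- can be accommodated.
  have h1 : (1 : Submodule ℝ C(S2, ℝ)) ≤ affineFunctions :=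
    Submodule.one_le.2 one_mem_affineFunctions
  induction hf using Algebra.adjoin_induction with
  | mem x hx =>
    obtain ⟨i, rfl⟩ := hx
    exact ⟨1, by simpa using coord_mem_affineFunctions i⟩
  | algebraMap r => exact ⟨0, by simp⟩
  | add x y _ _ hx hy =>
    obtain ⟨M, hM⟩ := hx
    obtain ⟨N, hN⟩ := hy
    exact ⟨M + N, Submodule.add_mem _ (pow_le_pow_right' h1 (by lia) hM)
      (pow_le_pow_right' h1 (by lia) hN)⟩
  | mul x y _ _ hx hy =>
    obtain ⟨M, hM⟩ := hx
    obtain ⟨N, hN⟩ := hy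
    exact ⟨M + N, by rw [pow_add]; exact Submodule.mul_mem_mul hM hN⟩

/-- Polynomials are finite sums of eigenfunctions, uniformly dense in C(𝕊²) by Stone–Weierstrass,
and continuous functions are dense in L². -/
theorem topologicalClosure_iSup_eigenspace :
    (⨆ lam, eigenspace lam).topologicalClosure = ⊤ := by
  have hsep : (Algebra.adjoin ℝ (Set.range coord)).SeparatesPoints := by
    intro σ τ hστ
    have : ∃ i, (σ : E3) i ≠ (τ : E3) i := by
      by_contra! h
      exact hστ (Subtype.ext (by ext i; exact h i))
    obtain ⟨i, hi⟩ := this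
    exact ⟨_, ⟨coord i, Algebra.subset_adjoin ⟨i, rfl⟩, rfl⟩, hi⟩
  have hA := ContinuousMap.subalgebra_topologicalClosure_eq_top_of_separatesPoints _ hsep
  have hd : Dense ((Algebra.adjoin ℝ (Set.range coord) : Set C(S2, ℝ))) := by
    rw [dense_iff_closure_eq, ← Subalgebra.topologicalClosure_coe, hA]
    rfl
  have hr := ContinuousMap.toLp_denseRange ℝ surfaceMeasure ℝ (p := 2) (by simp)
  have hi := hr.dense_image (ContinuousMap.toLp 2 surfaceMeasure ℝ).continuous hd
  rw [← Submodule.dense_iff_topologicalClosure_eq_top]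
  refine hi.mono ?_
  rintro _ ⟨f, hf, rfl⟩
  obtain ⟨N, hN⟩ := exists_mem_pow_of_mem_adjoin hf
  exact toLp_mem_iSup_eigenspace hN

theorem orthogonalFamily_eigenspace :
    OrthogonalFamily ℝ (fun lam => eigenspace lam) fun lam => (eigenspace lam).subtypeₗᵢ :=
  fun _ _ h u v => (isOrtho_eigenspace h).inner_eq u.2 v.2

end Polynomials

/-! ### The inequality on a line. -/

section OneDimensional

/-- A nonnegative function on the line with derivative `k` can decrease at the origin only at a
rate controlled by its value and by the fractional oscillation of `k` to the right of the origin. -/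
theorem neg_deriv_rpow_le {s : ℝ} (hs : 0 < s) {h k : ℝ → ℝ} (hk : Continuous k)
    (hd : ∀ u, HasDerivAt h (k u) u) (hh : ∀ u, 0 ≤ h u) (h0 : 0 < h 0) (hk0 : k 0 ≤ 0)
    (hi : IntegrableOn (fun u => u ^ (-1 - 2 * s) * (k u - k 0) ^ 2) (Set.Ioi 0)) :
    (-k 0) ^ (2 + 2 * s) ≤ 2 ^ (2 + 2 * s) * h 0 ^ (2 * s) *
      ((∫ u in Set.Ioi 0, u ^ (-1 - 2 * s) * (k u - k 0) ^ 2) + h 0 ^ 2) := by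
  set D := ∫ u in Set.Ioi 0, u ^ (-1 - 2 * s) * (k u - k 0) ^ 2 with hD
  have hD0 : 0 ≤ D := setIntegral_nonneg measurableSet_Ioi fun u hu =>
    mul_nonneg (Real.rpow_nonneg (le_of_lt hu) _) (sq_nonneg _)
  set M := D + h 0 ^ 2 with hM
  have hM0 : 0 < M := by positivity
  set p := -k 0 with hp
  have hp0 : 0 ≤ p := by linarith
  have he : (0 : ℝ) < 2 + 2 * s := by linarith
  -- The time `r` and the Young parameter `ε` are chosen so that each of the two error terms ε D / 2
  -- and r^(2+2s) / (2ε) is at most h(0) / 2. The summand h(0)² in `M` keeps `M` positive when `D`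
  -- vanishes.
  set q := h 0 ^ 2 / M with hq
  have hq0 : 0 < q := by positivity
  set r := q ^ (1 / (2 + 2 * s)) with hr
  have hr0 : 0 < r := by positivity
  have hrq : r ^ (2 + 2 * s) = q := by
    rw [hr, ← Real.rpow_mul hq0.le, one_div_mul_cancel he.ne', Real.rpow_one]
  set ε := h 0 / M with hε
  have hε0 : 0 < ε := by positivity
  -- Young's inequality with weight u^(1+2s); the difference of the two sides is a perfect square
  -- over a positive quantity.
  have hmain : ∀ u ∈ Set.Ioc 0 r, (k u - k 0) ≤
      ε / 2 * (u ^ (-1 - 2 * s) * (k u - k 0) ^ 2) + 1 / (2 * ε) * u ^ (1 + 2 * s) := by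
    intro u hu
    have hw : 0 < u ^ (1 + 2 * s) := Real.rpow_pos_of_pos hu.1 _
    have hw' : u ^ (-1 - 2 * s) = (u ^ (1 + 2 * s))⁻¹ := by
      rw [← Real.rpow_neg hu.1.le]; congr 1; ring
    rw [hw']
    set w := u ^ (1 + 2 * s)
    have : ε / 2 * (w⁻¹ * (k u - k 0) ^ 2) + 1 / (2 * ε) * w - (k u - k 0) =
        (ε * (k u - k 0) - w) ^ 2 / (2 * ε * w) := by
      field_simp; ring
    have h2 : 0 ≤ (ε * (k u - k 0) - w) ^ 2 / (2 * ε * w) := by positivity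
    linarith
  have hi' : IntegrableOn (fun u => u ^ (-1 - 2 * s) * (k u - k 0) ^ 2) (Set.Ioc 0 r) :=
    hi.mono_set Set.Ioc_subset_Ioi_self
  have hpow : IntervalIntegrable (fun u : ℝ => u ^ (1 + 2 * s)) volume 0 r :=
    intervalIntegral.intervalIntegrable_rpow' (by linarith)
  have hint : ∫ u in (0 : ℝ)..r, (k u - k 0) ≤ ε / 2 * D + 1 / (2 * ε) * q := by
    have h1 : ∫ u in (0 : ℝ)..r, (k u - k 0) ≤ ∫ u in (0 : ℝ)..r,
        (ε / 2 * (u ^ (-1 - 2 * s) * (k u - k 0) ^ 2) + 1 / (2 * ε) * u ^ (1 + 2 * s)) := by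
      rw [intervalIntegral.integral_of_le hr0.le, intervalIntegral.integral_of_le hr0.le]
      refine setIntegral_mono_on ?_ ?_ measurableSet_Ioc hmain
      · exact (Continuous.intervalIntegrable (by fun_prop) 0 r).1
      · exact (hi'.const_mul _).add (hpow.1.const_mul _)
    refine h1.trans ?_
    rw [intervalIntegral.integral_add, intervalIntegral.integral_const_mul,
      intervalIntegral.integral_const_mul, integral_rpow (Or.inl (by linarith)),
      intervalIntegral.integral_of_le hr0.le]
    · have h2 : ∫ u in Set.Ioc 0 r, u ^ (-1 - 2 * s) * (k u - k 0) ^ 2 ≤ D :=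
        setIntegral_mono_set hi ((ae_restrict_mem measurableSet_Ioi).mono fun u hu =>
          mul_nonneg (Real.rpow_nonneg (le_of_lt hu) _) (sq_nonneg _))
          (Filter.Eventually.of_forall Set.Ioc_subset_Ioi_self)
      have h3 : (r ^ (1 + 2 * s + 1) - 0 ^ (1 + 2 * s + 1)) / (1 + 2 * s + 1) ≤ q := by
        rw [show 1 + 2 * s + 1 = 2 + 2 * s by ring, hrq, Real.zero_rpow he.ne', sub_zero]
        exact div_le_self hq0.le (by linarith)
      gcongr
    · rw [intervalIntegrable_iff_integrableOn_Ioc_of_le hr0.le]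
      exact hi'.const_mul _
    · exact hpow.const_mul _
  have hftc : ∫ u in (0 : ℝ)..r, (k u - k 0) = h r - h 0 - r * k 0 := by
    rw [intervalIntegral.integral_sub (hk.intervalIntegrable _ _)
      (by simp), intervalIntegral.integral_eq_sub_of_hasDerivAt (fun u _ => hd u)
      (hk.intervalIntegrable _ _)]
    simp
  -- Nonnegativity of `h` enters here, at the single time `r`: the initial slope can be sustained
  -- only as far as h(0) and the error allow.
  have hrp : r * p ≤ 2 * h 0 := by
    have h1 : ε / 2 * D ≤ h 0 / 2 := by
      have : ε * D ≤ h 0 := by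
        rw [hε, div_mul_eq_mul_div, div_le_iff₀ hM0]
        gcongr
        nlinarith
      linarith
    have h2 : 1 / (2 * ε) * q = h 0 / 2 := by
      rw [hε, hq]; field_simp
    have h3 := hh r
    have h4 : r * p = -(r * k 0) := by rw [hp]; ring
    linarith
  have hfin : (r * p) ^ (2 + 2 * s) ≤ (2 * h 0) ^ (2 + 2 * s) :=
    Real.rpow_le_rpow (by positivity) hrp he.le
  rw [Real.mul_rpow hr0.le hp0, hrq, Real.mul_rpow (by norm_num) h0.le, Real.rpow_add h0,
    Real.rpow_two, hq, div_mul_eq_mul_div, div_le_iff₀ hM0] at hfin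
  have h02 : 0 < h 0 ^ 2 := by positivity
  refine le_of_mul_le_mul_left ?_ h02
  calc _ ≤ _ := hfin
    _ = _ := by ring

/-- The fractional oscillation at the origin, on the right, of a function on the line. -/
def oscillation (s : ℝ) (k : ℝ → ℝ) : ℝ≥0∞ :=
  ∫⁻ u in Set.Ioi 0, ENNReal.ofReal (u ^ (-1 - 2 * s) * (k u - k 0) ^ 2)

theorem ofReal_deriv_rpow_le_of_nonpos {s : ℝ} (hs : 0 < s) {h k : ℝ → ℝ} (hk : Continuous k)
    (hd : ∀ u, HasDerivAt h (k u) u) (hh : ∀ u, 0 ≤ h u) (hk0 : k 0 ≤ 0) :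
    ENNReal.ofReal (|k 0| ^ (2 + 2 * s) / h 0 ^ (2 * s)) ≤
      ENNReal.ofReal (2 ^ (2 + 2 * s)) * (oscillation s k + ENNReal.ofReal (h 0 ^ 2)) := by
  rcases (hh 0).eq_or_lt with h0 | h0
  -- Where h(0) = 0 the quotient is 0 by the convention for division by zero.
  · rw [← h0, Real.zero_rpow (by linarith), div_zero, ENNReal.ofReal_zero]
    exact zero_le
  by_cases htop : oscillation s k = ⊤
  · rw [htop, top_add, ENNReal.mul_top]
    · exact le_top
    · rw [Ne, ENNReal.ofReal_eq_zero, not_le]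
      positivity
  have hm : Measurable fun u : ℝ => u ^ (-1 - 2 * s) * (k u - k 0) ^ 2 := by
    have := hk.measurable
    fun_prop
  have hnn : 0 ≤ᵐ[volume.restrict (Set.Ioi 0)] fun u => u ^ (-1 - 2 * s) * (k u - k 0) ^ 2 :=
    (ae_restrict_mem measurableSet_Ioi).mono fun u hu =>
      mul_nonneg (Real.rpow_nonneg (le_of_lt hu) _) (sq_nonneg _)
  have hi : IntegrableOn (fun u => u ^ (-1 - 2 * s) * (k u - k 0) ^ 2) (Set.Ioi 0) :=
    ⟨hm.aestronglyMeasurable, (hasFiniteIntegral_iff_ofReal hnn).2 (Ne.lt_top htop)⟩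
  have key := neg_deriv_rpow_le hs hk hd hh h0 hk0 hi
  rw [oscillation, ← ofReal_integral_eq_lintegral_ofReal hi hnn,
    ← ENNReal.ofReal_add (integral_nonneg_of_ae hnn) (sq_nonneg _),
    ← ENNReal.ofReal_mul (by positivity)]
  refine ENNReal.ofReal_le_ofReal ?_
  rw [abs_of_nonpos hk0, div_le_iff₀ (by positivity)]
  linarith

/-- A nonnegative function on the line with derivative `k` varies at the origin at a rate
controlled by its value and by the fractional oscillation of `k` on both sides. -/
theorem ofReal_deriv_rpow_le {s : ℝ} (hs : 0 < s) {h k : ℝ → ℝ} (hk : Continuous k)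
    (hd : ∀ u, HasDerivAt h (k u) u) (hh : ∀ u, 0 ≤ h u) :
    ENNReal.ofReal (|k 0| ^ (2 + 2 * s) / h 0 ^ (2 * s)) ≤ ENNReal.ofReal (2 ^ (2 + 2 * s)) *
      (oscillation s k + oscillation s (fun u => k (-u)) + ENNReal.ofReal (h 0 ^ 2)) := by
  rcases le_total (k 0) 0 with hk0 | hk0
  · refine (ofReal_deriv_rpow_le_of_nonpos hs hk hd hh hk0).trans ?_
    gcongr
    exact le_self_add
  · have hd' (u : ℝ) : HasDerivAt (fun u => h (-u)) (-k (-u)) u := by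
      simpa using! (hd (-u)).scomp u (hasDerivAt_neg u)
    have := ofReal_deriv_rpow_le_of_nonpos (h := fun u => h (-u)) (k := fun u => -k (-u)) hs
      (by fun_prop) hd' (fun u => hh _) (by simpa using hk0)
    have ho : oscillation s (fun u => -k (-u)) = oscillation s (fun u => k (-u)) := by
      simp only [oscillation]
      congr 1 with u
      congr 2
      ring
    simp only [neg_zero, abs_neg, ho] at this
    refine this.trans ?_
    gcongr
    exact le_add_self

end OneDimensional

/-! ### The spectral bound for mixed differences. -/

section Spectral

/-- Split at u = λ^(-1/2), the scale of the eigenfunctions. Below it the quadratic bound is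
integrable because s < 1, above it the constant bound because s > 0; both pieces scale like λ^(1+s).
-/
theorem lintegral_rpow_mul_min_le {s : ℝ} (hs0 : 0 < s) (hs1 : s < 1) (lam : ℝ≥0) :
    ∫⁻ u in Set.Ioi (0 : ℝ), ENNReal.ofReal (u ^ (-1 - 2 * s) * min (8 * (lam : ℝ)) (4 * lam ^ 2 * u ^ 2))
      ≤ ENNReal.ofReal (2 / (1 - s) + 4 / s) * ((lam ^ (1 + s) : ℝ≥0) : ℝ≥0∞) := by
  rcases eq_or_ne lam 0 with rfl | hlam
  · simp
  have hl : (0 : ℝ) < lam := by positivity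
  set l : ℝ := (lam : ℝ) with hldef
  set a : ℝ := l ^ (-1 / 2 : ℝ) with ha
  have ha0 : 0 < a := by positivity
  have hs1' : 0 < 1 - s := by linarith
  rw [← Set.Ioc_union_Ioi_eq_Ioi ha0.le]
  refine (lintegral_union_le _ _ _).trans ?_
  have h1 : ∫⁻ u in Set.Ioc 0 a, ENNReal.ofReal (u ^ (-1 - 2 * s) * min (8 * l) (4 * l ^ 2 * u ^ 2))
      ≤ ENNReal.ofReal (2 / (1 - s) * l ^ (1 + s)) := by
    have hint : IntegrableOn (fun u : ℝ => 4 * l ^ 2 * u ^ (1 - 2 * s)) (Set.Ioc 0 a) := by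
      rw [← intervalIntegrable_iff_integrableOn_Ioc_of_le ha0.le]
      exact (intervalIntegral.intervalIntegrable_rpow' (by linarith)).const_mul _
    calc _ ≤ ∫⁻ u in Set.Ioc 0 a, ENNReal.ofReal (4 * l ^ 2 * u ^ (1 - 2 * s)) := by
          refine setLIntegral_mono' measurableSet_Ioc fun u hu => ENNReal.ofReal_le_ofReal ?_
          have hu0 : 0 < u := hu.1
          have e : u ^ (1 - 2 * s) = u ^ (-1 - 2 * s) * u ^ 2 := by
            rw [← Real.rpow_two, ← Real.rpow_add hu0]; congr 1; ring
          rw [e]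
          calc _ ≤ u ^ (-1 - 2 * s) * (4 * l ^ 2 * u ^ 2) := by gcongr; exact min_le_right _ _
            _ = _ := by ring
      _ = ENNReal.ofReal (∫ u in Set.Ioc 0 a, 4 * l ^ 2 * u ^ (1 - 2 * s)) := by
          rw [ofReal_integral_eq_lintegral_ofReal hint]
          exact (ae_restrict_mem measurableSet_Ioc).mono fun u hu =>
            mul_nonneg (by positivity) (Real.rpow_nonneg hu.1.le _)
      _ = _ := by
          rw [← intervalIntegral.integral_of_le ha0.le, intervalIntegral.integral_const_mul,
            integral_rpow (Or.inl (by linarith)), Real.zero_rpow (by linarith), sub_zero,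
            ha, ← Real.rpow_mul hl.le]
          congr 1
          have e : l ^ (1 + s) = l ^ 2 * l ^ (-1 / 2 * (1 - 2 * s + 1)) := by
            rw [← Real.rpow_two, ← Real.rpow_add hl]; congr 1; ring
          rw [e, show 1 - 2 * s + 1 = 2 * (1 - s) by ring]
          field_simp
          ring
  have h2 : ∫⁻ u in Set.Ioi a, ENNReal.ofReal (u ^ (-1 - 2 * s) * min (8 * l) (4 * l ^ 2 * u ^ 2))
      ≤ ENNReal.ofReal (4 / s * l ^ (1 + s)) := by
    have hint : IntegrableOn (fun u : ℝ => 8 * l * u ^ (-1 - 2 * s)) (Set.Ioi a) :=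
      (integrableOn_Ioi_rpow_of_lt (by linarith) ha0).const_mul _
    calc _ ≤ ∫⁻ u in Set.Ioi a, ENNReal.ofReal (8 * l * u ^ (-1 - 2 * s)) := by
          refine setLIntegral_mono' measurableSet_Ioi fun u hu => ENNReal.ofReal_le_ofReal ?_
          have hu0 : 0 < u := ha0.trans hu
          calc _ ≤ u ^ (-1 - 2 * s) * (8 * l) := by gcongr; exact min_le_left _ _
            _ = _ := by ring
      _ = ENNReal.ofReal (∫ u in Set.Ioi a, 8 * l * u ^ (-1 - 2 * s)) := by
          rw [ofReal_integral_eq_lintegral_ofReal hint]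
          exact (ae_restrict_mem measurableSet_Ioi).mono fun u hu =>
            mul_nonneg (by positivity) (Real.rpow_nonneg (ha0.trans hu).le _)
      _ = _ := by
          rw [integral_const_mul, integral_Ioi_rpow_of_lt (by linarith) ha0, ha,
            ← Real.rpow_mul hl.le]
          congr 1
          have e : l ^ (1 + s) = l * l ^ (-1 / 2 * (-1 - 2 * s + 1)) := by
            rw [← Real.rpow_one_add' hl.le (by linarith)]; congr 1; ring
          rw [e, show -1 - 2 * s + 1 = -(2 * s) by ring]
          field_simp
          ring
  refine (add_le_add h1 h2).trans ?_
  rw [← ENNReal.ofReal_add (by positivity) (by positivity), ← add_mul,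
    ENNReal.ofReal_mul (by positivity)]
  gcongr
  rw [← NNReal.coe_rpow, ENNReal.ofReal_coe_nnreal]

/-- The operator `(U_u - 1) (U_t - 1)` on `L²(𝕊²)`, where `U` is the action of the flow of `A`. -/
def mixedDiff (A : Skew) (u t : ℝ) : L2 →L[ℝ] L2 :=
  ((flowL2 A u).toContinuousLinearMap - ContinuousLinearMap.id ℝ L2) ∘L
    ((flowL2 A t).toContinuousLinearMap - ContinuousLinearMap.id ℝ L2)

theorem mixedDiff_apply (A : Skew) (u t : ℝ) (v : L2) :
    mixedDiff A u t v = flowL2 A u (flowL2 A t v - v) - (flowL2 A t v - v) := rfl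

/-- The difference in `t` always gains 2λt². The one in `u` costs either a factor 4, rotations being
isometries, or 2λu², since the first difference stays in the eigenspace. -/
theorem norm_mixedDiff_sq_le (j k : Fin 3) {u t : ℝ} (hu : 0 < u) (ht : 0 < t) {lam : ℝ≥0}
    {v : L2} (hv : v ∈ eigenspace lam) :
    ‖mixedDiff (coordRot j k) u t v‖ ^ 2 ≤
      t ^ 2 * min (8 * (lam : ℝ)) (4 * lam ^ 2 * u ^ 2) * ‖v‖ ^ 2 := by
  set w := flowL2 (coordRot j k) t v - v with hw
  have hwm : w ∈ eigenspace lam := Submodule.sub_mem _ (flowL2_mem_eigenspace _ t hv) hv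
  have h1 : ‖w‖ ^ 2 ≤ 2 * lam * t ^ 2 * ‖v‖ ^ 2 := norm_flowL2_sub_sq_le j k ht hv
  have h2 : ‖mixedDiff (coordRot j k) u t v‖ ^ 2 ≤ 2 * lam * u ^ 2 * ‖w‖ ^ 2 :=
    norm_flowL2_sub_sq_le j k hu hwm
  have h3 : ‖mixedDiff (coordRot j k) u t v‖ ≤ 2 * ‖w‖ := by
    rw [mixedDiff_apply, ← hw]
    refine (norm_sub_le _ _).trans ?_
    rw [(flowL2 _ u).norm_map]
    linarith
  have h4 : ‖mixedDiff (coordRot j k) u t v‖ ^ 2 ≤ 4 * ‖w‖ ^ 2 := by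
    calc _ ≤ (2 * ‖w‖) ^ 2 := by gcongr
      _ = _ := by ring
  rw [mul_min_of_nonneg _ _ (by positivity), min_mul_of_nonneg _ _ (by positivity)]
  refine le_min ?_ ?_
  · calc _ ≤ _ := h4
      _ ≤ 4 * (2 * lam * t ^ 2 * ‖v‖ ^ 2) := by gcongr
      _ = _ := by ring
  · calc _ ≤ _ := h2
      _ ≤ 2 * lam * u ^ 2 * (2 * lam * t ^ 2 * ‖v‖ ^ 2) := by gcongr
      _ = _ := by ring

theorem mixedDiff_mem_eigenspace (A : Skew) (u t : ℝ) {lam : ℝ≥0} {v : L2}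
    (hv : v ∈ eigenspace lam) : mixedDiff A u t v ∈ eigenspace lam := by
  have hw := Submodule.sub_mem _ (flowL2_mem_eigenspace A t hv) hv
  exact Submodule.sub_mem _ (flowL2_mem_eigenspace A u hw) hw

theorem hasSum_norm_starProjection_eigenspace_sq (v : L2) :
    HasSum (fun lam => ‖(eigenspace lam).starProjection v‖ ^ 2) (‖v‖ ^ 2) :=
  hasSum_norm_sq_starProjection orthogonalFamily_eigenspace topologicalClosure_iSup_eigenspace
    (ContinuousLinearMap.id ℝ L2) (fun _ _ h => h) v

/-- The square of the spectral Sobolev seminorm. -/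
def sobolevSum (ν : ℝ) (v : L2) : ℝ≥0∞ :=
  ∑' lam : ℝ≥0, ((lam ^ ν : ℝ≥0) : ℝ≥0∞) * ‖(eigenspace lam).starProjection v‖ₑ ^ 2

theorem sobolevSeminorm_sq (ν : ℝ) (v : L2) : sobolevSeminorm ν v ^ 2 = sobolevSum ν v := by
  rw [sobolevSeminorm, ← ENNReal.rpow_natCast, ← ENNReal.rpow_mul]
  norm_num [sobolevSum]

theorem ofReal_norm_sq {H : Type*} [NormedAddCommGroup H] (v : H) :
    ENNReal.ofReal (‖v‖ ^ 2) = ‖v‖ₑ ^ 2 := by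
  rw [ENNReal.ofReal_pow (norm_nonneg _), ofReal_norm]

theorem lintegral_mixedDiff_le {s : ℝ} (hs0 : 0 < s) (hs1 : s < 1) (j k : Fin 3) {t : ℝ}
    (ht : 0 < t) (v : L2) :
    ∫⁻ u in Set.Ioi (0 : ℝ), ENNReal.ofReal (u ^ (-1 - 2 * s) *
        ‖mixedDiff (coordRot j k) u t v‖ ^ 2) ≤
      ENNReal.ofReal (t ^ 2) * ENNReal.ofReal (2 / (1 - s) + 4 / s) * sobolevSum (1 + s) v := by
  set P : ℝ≥0 → L2 := fun lam => (eigenspace lam).starProjection v with hP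
  have hPm (lam : ℝ≥0) : P lam ∈ eigenspace lam := Submodule.starProjection_apply_mem _ _
  -- Only countably many components of `v` are nonzero; this permits exchanging the integral with a
  -- sum indexed by all nonnegative reals.
  let Λ : Set ℝ≥0 := Function.support fun lam => ‖P lam‖ ^ 2
  have hΛ : Λ.Countable := (hasSum_norm_starProjection_eigenspace_sq v).summable.countable_support
  have : Countable Λ := hΛ.to_subtype
  have hsupp (c : ℝ≥0 → ℝ≥0∞) :
      ∑' lam, c lam * ‖P lam‖ₑ ^ 2 = ∑' lam : Λ, c lam * ‖P lam‖ₑ ^ 2 := by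
    refine (tsum_subtype_eq_of_support_subset fun lam hlam => ?_).symm
    simp only [Function.mem_support, Λ] at *
    intro h0
    apply hlam
    simp [norm_eq_zero.1 (pow_eq_zero_iff two_ne_zero |>.1 h0)]
  set m : ℝ≥0 → ℝ → ℝ := fun lam u => u ^ (-1 - 2 * s) * min (8 * (lam : ℝ)) (4 * lam ^ 2 * u ^ 2)
    with hm
  have hpt (u : ℝ) (hu : u ∈ Set.Ioi 0) :
      ENNReal.ofReal (u ^ (-1 - 2 * s) * ‖mixedDiff (coordRot j k) u t v‖ ^ 2) ≤
        ENNReal.ofReal (t ^ 2) * ∑' lam : Λ, ENNReal.ofReal (m lam u) * ‖P lam‖ₑ ^ 2 := by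
    have hu0 : 0 < u := hu
    have hsum := hasSum_norm_sq_starProjection orthogonalFamily_eigenspace
      topologicalClosure_iSup_eigenspace (mixedDiff (coordRot j k) u t)
      (fun _ _ h => mixedDiff_mem_eigenspace _ u t h) v
    rw [← hsupp fun lam => ENNReal.ofReal (m lam u), ← ENNReal.tsum_mul_left, ENNReal.ofReal_mul (by positivity), ← hsum.tsum_eq,
      ENNReal.ofReal_tsum_of_nonneg (fun _ => sq_nonneg _) hsum.summable, ← ENNReal.tsum_mul_left]
    refine ENNReal.tsum_le_tsum fun lam => ?_
    rw [← ofReal_norm_sq, ← ENNReal.ofReal_mul (by positivity), ← ENNReal.ofReal_mul (by positivity),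
      ← ENNReal.ofReal_mul (by positivity)]
    refine ENNReal.ofReal_le_ofReal ?_
    calc _ ≤ u ^ (-1 - 2 * s) * (t ^ 2 * min (8 * (lam : ℝ)) (4 * lam ^ 2 * u ^ 2) * ‖P lam‖ ^ 2) := by
          gcongr
          exact norm_mixedDiff_sq_le j k hu0 ht (hPm lam)
      _ = _ := by rw [hm]; ring
  have hmeas (lam : ℝ≥0) : Measurable fun u => ENNReal.ofReal (m lam u) := by
    simp only [hm]
    fun_prop
  calc _ ≤ ∫⁻ u in Set.Ioi (0 : ℝ), ENNReal.ofReal (t ^ 2) *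
        ∑' lam : Λ, ENNReal.ofReal (m lam u) * ‖P lam‖ₑ ^ 2 :=
        setLIntegral_mono' measurableSet_Ioi hpt
    _ = ENNReal.ofReal (t ^ 2) * ∑' lam : Λ,
        (∫⁻ u in Set.Ioi (0 : ℝ), ENNReal.ofReal (m lam u)) * ‖P lam‖ₑ ^ 2 := by
        rw [lintegral_const_mul' _ _ ENNReal.ofReal_ne_top, lintegral_tsum]
        · congr 2 with lam
          rw [lintegral_mul_const _ (hmeas lam)]
        · exact fun lam => ((hmeas lam).mul_const _).aemeasurable
    _ ≤ ENNReal.ofReal (t ^ 2) * ∑' lam : Λ, ENNReal.ofReal (2 / (1 - s) + 4 / s) *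
        ((((lam : ℝ≥0) ^ (1 + s) : ℝ≥0) : ℝ≥0∞) * ‖P lam‖ₑ ^ 2) := by
        refine mul_le_mul_right (ENNReal.tsum_le_tsum fun lam => ?_) _
        rw [← mul_assoc]
        refine mul_le_mul_left ?_ _
        exact lintegral_rpow_mul_min_le hs0 hs1 lam
    _ = _ := by
        rw [ENNReal.tsum_mul_left, sobolevSum, mul_assoc,
          hsupp fun lam => ((lam ^ (1 + s) : ℝ≥0) : ℝ≥0∞)]

end Spectral

/-! ### Averages and difference quotients along a flow. -/

section DifferenceQuotients

/-- The difference quotient of `f` along the flow of `A`. -/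
def diffQuot (A : Skew) (t : ℝ) (f : S2 → ℝ) (σ : S2) : ℝ := (f (flow A t σ) - f σ) / t

/-- The average of `f` along the flow of `A`. -/
def flowAvg (A : Skew) (t : ℝ) (f : S2 → ℝ) (σ : S2) : ℝ :=
  t⁻¹ * ∫ v in (0 : ℝ)..t, f (flow A v σ)

variable (A : Skew) {f : S2 → ℝ} (hf : Continuous f)
include hf

theorem continuous_diffQuot (t : ℝ) : Continuous (diffQuot A t f) := by
  have := continuous_flow_right A t
  unfold diffQuot
  fun_prop

theorem continuous_flowAvg (t : ℝ) : Continuous (flowAvg A t f) :=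
  continuous_const.mul (intervalIntegral.continuous_parametric_intervalIntegral_of_continuous'
    (f := fun σ v => f (flow A v σ)) (hf.comp ((continuous_flow A).comp continuous_swap)) _ _)

/-- Along an orbit the average is an integral over the moving window from u to u + t, so it is
differentiable even when `f` is merely continuous. -/
theorem hasDerivAt_flowAvg (t : ℝ) (σ : S2) (u : ℝ) :
    HasDerivAt (fun u => flowAvg A t f (flow A u σ)) (diffQuot A t f (flow A u σ)) u := by
  have hF : Continuous fun v => f (flow A v σ) := hf.comp (continuous_flow_left A σ)
  have hint (a b : ℝ) : IntervalIntegrable (fun v => f (flow A v σ)) volume a b :=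
    hF.intervalIntegrable a b
  have h1 (u : ℝ) : HasDerivAt (fun x => ∫ v in (0 : ℝ)..x, f (flow A v σ)) (f (flow A u σ)) u :=
    intervalIntegral.integral_hasDerivAt_right (hint _ _)
      hF.stronglyMeasurable.stronglyMeasurableAtFilter hF.continuousAt
  have h2 := (((h1 (t + u)).comp_const_add t u).sub (h1 u)).const_mul t⁻¹
  have e : (fun u => flowAvg A t f (flow A u σ)) = fun u => t⁻¹ *
      ((∫ v in (0 : ℝ)..(t + u), f (flow A v σ)) - ∫ v in (0 : ℝ)..u, f (flow A v σ)) := by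
    ext x
    simp only [flowAvg, ← flow_add]
    rw [intervalIntegral.integral_comp_add_right (fun v => f (flow A v σ)), zero_add,
      intervalIntegral.integral_interval_sub_left (hint _ _) (hint _ _)]
  rw [e, diffQuot, ← flow_add, div_eq_inv_mul]
  exact h2

theorem integral_flowAvg_sq_le {t : ℝ} (ht : 0 < t) :
    ∫ σ, flowAvg A t f σ ^ 2 ∂surfaceMeasure ≤ ∫ σ, f σ ^ 2 ∂surfaceMeasure := by
  have e := integral_intervalIntegral_comp_flow A ht.le (hf.pow 2)
  simp only [Pi.pow_apply] at e
  have e' : ∫ σ, f σ ^ 2 ∂surfaceMeasure =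
      ∫ σ, t⁻¹ * (∫ u in (0 : ℝ)..t, f (flow A u σ) ^ 2) ∂surfaceMeasure := by
    rw [integral_const_mul, e, inv_mul_cancel_left₀ ht.ne']
  rw [e']
  refine integral_mono (integrable_of_continuous ((continuous_flowAvg A hf t).pow 2))
    (integrable_of_continuous (continuous_flowAvg A (hf.pow 2) t)) fun σ => ?_
  have h := sq_intervalIntegral_le (hf.comp (continuous_flow_left A σ)) ht
  simp only [flowAvg, Function.comp_apply] at *
  calc _ = t⁻¹ * (t⁻¹ * (∫ v in (0 : ℝ)..t, f (flow A v σ)) ^ 2) := by ring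
    _ ≤ t⁻¹ * (t⁻¹ * (t * ∫ u in (0 : ℝ)..t, f (flow A u σ) ^ 2)) := by gcongr
    _ = _ := by rw [inv_mul_cancel_left₀ ht.ne']

theorem lintegral_ofReal_sq : ∫⁻ σ, ENNReal.ofReal (f σ ^ 2) ∂surfaceMeasure =
    ENNReal.ofReal (∫ σ, f σ ^ 2 ∂surfaceMeasure) :=
  (ofReal_integral_eq_lintegral_ofReal (integrable_of_continuous (hf.pow 2))
    (Filter.Eventually.of_forall fun _ => sq_nonneg _)).symm

theorem measurable_oscillation_flow (s : ℝ) {θ : ℝ → ℝ} (hθ : Continuous θ) :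
    Measurable fun p : S2 × ℝ => ENNReal.ofReal
      (p.2 ^ (-1 - 2 * s) * (f (flow A (θ p.2) p.1) - f (flow A (θ 0) p.1)) ^ 2) := by
  have h1 : Measurable fun p : S2 × ℝ => f (flow A (θ p.2) p.1) :=
    (hf.comp ((continuous_flow A).comp
      ((hθ.comp continuous_snd).prodMk continuous_fst))).measurable
  have h2 : Measurable fun p : S2 × ℝ => f (flow A (θ 0) p.1) :=
    (hf.comp ((continuous_flow_right A _).comp continuous_fst)).measurable
  exact ((measurable_snd.pow_const _).mul ((h1.sub h2).pow_const 2)).ennreal_ofReal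

theorem lintegral_oscillation_flow (s : ℝ) {θ : ℝ → ℝ} (hθ : Continuous θ) (hθ0 : θ 0 = 0) :
    ∫⁻ σ, oscillation s (fun u => f (flow A (θ u) σ)) ∂surfaceMeasure =
      ∫⁻ u in Set.Ioi (0 : ℝ), ENNReal.ofReal
        (u ^ (-1 - 2 * s) * ∫ σ, (f (flow A (θ u) σ) - f σ) ^ 2 ∂surfaceMeasure) := by
  simp only [oscillation]
  rw [lintegral_lintegral_swap (measurable_oscillation_flow A hf s hθ).aemeasurable]
  refine setLIntegral_congr_fun measurableSet_Ioi fun u hu => ?_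
  have hu0 : 0 < u := hu
  have hw : 0 ≤ u ^ (-1 - 2 * s) := by positivity
  have hc : Continuous fun σ => f (flow A (θ u) σ) - f σ := by
    have := continuous_flow_right A (θ u)
    fun_prop
  simp only [hθ0, flow_zero, ENNReal.ofReal_mul hw]
  rw [lintegral_const_mul' _ _ ENNReal.ofReal_ne_top, lintegral_ofReal_sq hc]

/-- Invariance of the measure under the flow for time `u`; it makes the left oscillation equal to
the right one after integration. -/
theorem integral_sub_comp_flow_neg_sq (u : ℝ) :
    ∫ σ, (f (flow A (-u) σ) - f σ) ^ 2 ∂surfaceMeasure =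
      ∫ σ, (f (flow A u σ) - f σ) ^ 2 ∂surfaceMeasure := by
  have hc : Continuous fun σ => (f (flow A (-u) σ) - f σ) ^ 2 := by
    have := continuous_flow_right A (-u)
    fun_prop
  rw [← integral_comp_flow A u hc]
  congr 1 with σ
  rw [← flow_add, neg_add_cancel, flow_zero]
  ring

theorem integral_diffQuot_sub_sq (u t : ℝ) :
    ∫ σ, (diffQuot A t f (flow A u σ) - diffQuot A t f σ) ^ 2 ∂surfaceMeasure =
      (t ^ 2)⁻¹ * ‖mixedDiff A u t (toL2 f hf)‖ ^ 2 := by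
  rw [mixedDiff_apply, flowL2_toL2, toL2_sub, flowL2_toL2, toL2_sub, norm_toL2_sq,
    ← integral_const_mul]
  congr 1 with σ
  simp only [diffQuot, Pi.sub_apply, Function.comp_apply, div_eq_mul_inv]
  ring

end DifferenceQuotients

/-! ### The integrated estimate, uniform in the step. -/

section MainEstimate

variable {s : ℝ} (hs0 : 0 < s) (hs1 : s < 1) (j k : Fin 3) {f : S2 → ℝ} (hf : Continuous f)
include hs0 hs1 hf

/-- The t² gained by the mixed difference cancels the t⁻² of the difference quotient, leaving a
bound independent of `t`. The two choices of `θ` are the two sides of the origin. -/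
theorem lintegral_oscillation_diffQuot_le {t : ℝ} (ht : 0 < t) {θ : ℝ → ℝ}
    (hθ : θ = id ∨ θ = Neg.neg) :
    ∫⁻ σ, oscillation s (fun u => diffQuot (coordRot j k) t f (flow (coordRot j k) (θ u) σ))
        ∂surfaceMeasure ≤
      ENNReal.ofReal (2 / (1 - s) + 4 / s) * sobolevSum (1 + s) (toL2 f hf) := by
  set A := coordRot j k
  have hc := continuous_diffQuot A hf t
  have e : ∫⁻ σ, oscillation s (fun u => diffQuot A t f (flow A (θ u) σ)) ∂surfaceMeasure =
      ∫⁻ u in Set.Ioi (0 : ℝ), ENNReal.ofReal (u ^ (-1 - 2 * s) *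
        ((t ^ 2)⁻¹ * ‖mixedDiff A u t (toL2 f hf)‖ ^ 2)) := by
    rcases hθ with rfl | rfl
    · rw [lintegral_oscillation_flow A hc s continuous_id rfl]
      simp only [id_eq, integral_diffQuot_sub_sq A hf]
    · rw [lintegral_oscillation_flow A hc s continuous_neg neg_zero]
      simp only [integral_sub_comp_flow_neg_sq A hc, integral_diffQuot_sub_sq A hf]
  have e' (u : ℝ) : ENNReal.ofReal (u ^ (-1 - 2 * s) *
        ((t ^ 2)⁻¹ * ‖mixedDiff A u t (toL2 f hf)‖ ^ 2)) = ENNReal.ofReal ((t ^ 2)⁻¹) *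
      ENNReal.ofReal (u ^ (-1 - 2 * s) * ‖mixedDiff A u t (toL2 f hf)‖ ^ 2) := by
    rw [← ENNReal.ofReal_mul (by positivity)]
    congr 1
    ring
  simp only [e, e']
  rw [lintegral_const_mul' _ _ ENNReal.ofReal_ne_top]
  refine (mul_le_mul_right (lintegral_mixedDiff_le hs0 hs1 j k ht (toL2 f hf)) _).trans_eq ?_
  rw [mul_assoc, ← mul_assoc, ← ENNReal.ofReal_mul (by positivity),
    inv_mul_cancel₀ (by positivity), ENNReal.ofReal_one, one_mul]

theorem lintegral_diffQuot_rpow_le (hf0 : ∀ σ, 0 ≤ f σ) {t : ℝ} (ht : 0 < t) :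
    ∫⁻ σ, ENNReal.ofReal (|diffQuot (coordRot j k) t f σ| ^ (2 + 2 * s) /
        flowAvg (coordRot j k) t f σ ^ (2 * s)) ∂surfaceMeasure ≤
      ENNReal.ofReal (2 ^ (2 + 2 * s)) *
        (2 * (ENNReal.ofReal (2 / (1 - s) + 4 / s) * sobolevSum (1 + s) (toL2 f hf)) +
          ∫⁻ σ, ENNReal.ofReal (f σ ^ 2) ∂surfaceMeasure) := by
  have hplus := lintegral_oscillation_diffQuot_le hs0 hs1 j k hf ht (Or.inl rfl)
  have hminus := lintegral_oscillation_diffQuot_le hs0 hs1 j k hf ht (Or.inr rfl)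
  set A := coordRot j k
  have hc := continuous_diffQuot A hf t
  have hpt (σ : S2) : ENNReal.ofReal (|diffQuot A t f σ| ^ (2 + 2 * s) /
        flowAvg A t f σ ^ (2 * s)) ≤ ENNReal.ofReal (2 ^ (2 + 2 * s)) *
      (oscillation s (fun u => diffQuot A t f (flow A (id u) σ)) +
        oscillation s (fun u => diffQuot A t f (flow A (-u) σ)) +
        ENNReal.ofReal (flowAvg A t f σ ^ 2)) := by
    have h := ofReal_deriv_rpow_le (h := fun u => flowAvg A t f (flow A u σ))
      (k := fun u => diffQuot A t f (flow A u σ)) hs0 (hc.comp (continuous_flow_left A σ))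
      (hasDerivAt_flowAvg A hf t σ) fun u => mul_nonneg (by positivity)
        (intervalIntegral.integral_nonneg ht.le fun v _ => hf0 _)
    simpa only [flow_zero, id_eq] using h
  refine (lintegral_mono hpt).trans ?_
  have hm1 : Measurable fun σ => oscillation s (fun u => diffQuot A t f (flow A (id u) σ)) :=
    (measurable_oscillation_flow A hc s continuous_id).lintegral_prod_right'
  have hm2 : Measurable fun σ => oscillation s (fun u => diffQuot A t f (flow A (-u) σ)) :=
    (measurable_oscillation_flow A hc s continuous_neg).lintegral_prod_right'
  have hm3 : Measurable fun σ => ENNReal.ofReal (flowAvg A t f σ ^ 2) :=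
    ((continuous_flowAvg A hf t).pow 2).measurable.ennreal_ofReal
  rw [lintegral_const_mul' _ _ ENNReal.ofReal_ne_top, lintegral_add_right _ hm3,
    lintegral_add_left hm1]
  refine mul_le_mul_right (add_le_add ((add_le_add hplus hminus).trans_eq (two_mul _).symm) ?_) _
  rw [lintegral_ofReal_sq (continuous_flowAvg A hf t), lintegral_ofReal_sq hf]
  exact ENNReal.ofReal_le_ofReal (integral_flowAvg_sq_le A hf ht)

end MainEstimate

/-! ### Passage to the limit and return to the gradient of log g. -/

section Gradient

theorem tendsto_flowAvg (A : Skew) {f : S2 → ℝ} (hf : Continuous f) (σ : S2) :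
    Filter.Tendsto (fun t => flowAvg A t f σ) (nhdsWithin 0 {0}ᶜ) (nhds (f σ)) := by
  have hF : Continuous fun v => f (flow A v σ) := hf.comp (continuous_flow_left A σ)
  have h1 : HasDerivAt (fun x => ∫ v in (0 : ℝ)..x, f (flow A v σ)) (f (flow A 0 σ)) 0 :=
    intervalIntegral.integral_hasDerivAt_right (hF.intervalIntegrable _ _)
      hF.stronglyMeasurable.stronglyMeasurableAtFilter hF.continuousAt
  simpa [flowAvg] using! h1.tendsto_slope_zero

theorem tendsto_diffQuot (A : Skew) {f : S2 → ℝ} {σ : S2} {d : ℝ}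
    (hd : HasDerivAt (fun u => f (flow A u σ)) d 0) :
    Filter.Tendsto (fun t => diffQuot A t f σ) (nhdsWithin 0 {0}ᶜ) (nhds d) := by
  simpa [diffQuot, div_eq_inv_mul] using! hd.tendsto_slope_zero

/-- The lower limit, as the step tends to zero, of the difference quotients that approximate
`|∇f|^(2 + 2s) / f^(2s)` in the direction of the infinitesimal rotation `A`. -/
def liminfQuot (s : ℝ) (A : Skew) (f : S2 → ℝ) (σ : S2) : ℝ≥0∞ :=
  Filter.liminf (fun n : ℕ => ENNReal.ofReal (|diffQuot A (1 / (n + 1)) f σ| ^ (2 + 2 * s) /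
    flowAvg A (1 / (n + 1)) f σ ^ (2 * s))) Filter.atTop

theorem liminfQuot_eq {s : ℝ} (hs0 : 0 < s) (A : Skew) {f : S2 → ℝ} (hf : Continuous f) {σ : S2}
    (hσ : 0 < f σ) {d : ℝ} (hd : HasDerivAt (fun u => f (flow A u σ)) d 0) :
    liminfQuot s A f σ = ENNReal.ofReal (|d| ^ (2 + 2 * s) / f σ ^ (2 * s)) := by
  have hn : Filter.Tendsto (fun n : ℕ => 1 / ((n : ℝ) + 1)) Filter.atTop
      (nhdsWithin 0 {0}ᶜ) :=
    tendsto_nhdsWithin_iff.2 ⟨tendsto_one_div_add_atTop_nhds_zero_nat,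
      Filter.Eventually.of_forall fun n => by
        simp only [Set.mem_compl_iff, Set.mem_singleton_iff]
        positivity⟩
  refine Filter.Tendsto.liminf_eq (ENNReal.tendsto_ofReal ?_)
  refine Filter.Tendsto.div ?_ ?_ (by positivity)
  · exact (((tendsto_diffQuot A hd).comp hn).abs).rpow_const (Or.inr (by linarith))
  · exact ((tendsto_flowAvg A hf σ).comp hn).rpow_const (Or.inr (by linarith))

theorem measurable_quot (s t : ℝ) (A : Skew) {f : S2 → ℝ} (hf : Continuous f) :
    Measurable fun σ => ENNReal.ofReal (|diffQuot A t f σ| ^ (2 + 2 * s) /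
      flowAvg A t f σ ^ (2 * s)) := by
  have h1 := (continuous_diffQuot A hf t).measurable
  have h2 := (continuous_flowAvg A hf t).measurable
  fun_prop

theorem measurable_liminfQuot (s : ℝ) (A : Skew) {f : S2 → ℝ} (hf : Continuous f) :
    Measurable (liminfQuot s A f) :=
  Measurable.liminf fun _ => measurable_quot s _ A hf

/-- Fatou's lemma along the steps 1/(n+1), with a bound that does not depend on n. -/
theorem lintegral_liminfQuot_le {s : ℝ} (hs0 : 0 < s) (hs1 : s < 1) (j k : Fin 3) {f : S2 → ℝ}
    (hf : Continuous f) (hf0 : ∀ σ, 0 ≤ f σ) :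
    ∫⁻ σ, liminfQuot s (coordRot j k) f σ ∂surfaceMeasure ≤ ENNReal.ofReal (2 ^ (2 + 2 * s)) *
        (2 * (ENNReal.ofReal (2 / (1 - s) + 4 / s) * sobolevSum (1 + s) (toL2 f hf)) +
          ∫⁻ σ, ENNReal.ofReal (f σ ^ 2) ∂surfaceMeasure) := by
  refine (lintegral_liminf_le fun n => measurable_quot s _ _ hf).trans ?_
  refine (Filter.liminf_le_liminf (Filter.Eventually.of_forall fun n : ℕ =>
    lintegral_diffQuot_rpow_le hs0 hs1 j k hf hf0 (t := 1 / ((n : ℝ) + 1))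
      (by positivity))).trans_eq ?_
  exact Filter.liminf_const _

theorem norm_sphGradient_le {Y : S2 → ℝ} {σ : S2} (hY : DifferentiableAt ℝ (radialExt Y) σ) :
    ∃ j k, ‖sphGradient Y σ‖ ≤ 3 * |lieDeriv (coordRot j k) Y σ| := by
  set v := sphGradient Y σ with hv
  have hin (x : E3) : inner ℝ v x = fderiv ℝ (radialExt Y) σ x := by
    rw [hv, sphGradient, gradient, InnerProductSpace.toDual_symm_apply]
  have h := sum_bilin_coordRot ((fderiv ℝ (radialExt Y) σ).smulRight
    (fderiv ℝ (radialExt Y) (σ : E3))) σ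
  have hnorm : ‖v‖ ^ 2 = ∑ i, fderiv ℝ (radialExt Y) σ (EuclideanSpace.single i (1 : ℝ)) ^ 2 := by
    rw [EuclideanSpace.norm_sq_eq]
    refine Finset.sum_congr rfl fun i _ => ?_
    rw [← hin]
    simp [EuclideanSpace.inner_single_right]
  simp only [ContinuousLinearMap.smulRight_apply, smul_apply, smul_eq_mul,
    fderiv_radialExt_coe σ hY, norm_eq_of_mem_sphere, ← sq, ← hnorm] at h
  by_contra! hcon
  have hlt (j k : Fin 3) : 9 * lieDeriv (coordRot j k) Y σ ^ 2 < ‖v‖ ^ 2 := by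
    have := hcon j k
    calc _ = (3 * |lieDeriv (coordRot j k) Y σ|) ^ 2 := by rw [mul_pow, sq_abs]; norm_num
      _ < _ := by gcongr
  -- The nine squares add up to 2‖v‖², so this would read 18‖v‖² < 9‖v‖².
  have hsum : ∑ j, ∑ k, 9 * lieDeriv (coordRot j k) Y σ ^ 2 < ∑ _j : Fin 3, ∑ _k : Fin 3, ‖v‖ ^ 2 :=
    Finset.sum_lt_sum_of_nonempty Finset.univ_nonempty fun j _ =>
      Finset.sum_lt_sum_of_nonempty Finset.univ_nonempty fun k _ => hlt j k
  simp only [← Finset.mul_sum, lieDeriv, h] at hsum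
  simp at hsum
  nlinarith [sq_nonneg ‖v‖]

variable {s : ℝ} (hs0 : 0 < s) {g : S2 → ℝ} (hg : IsSmooth g)
include hg

theorem hasDerivAt_sqrt_comp_flow (A : Skew) {σ : S2} (hσ : 0 < g σ) :
    HasDerivAt (fun u => √(g (flow A u σ))) (lieDeriv A g σ / (2 * √(g σ))) 0 := by
  have h := (hasDerivAt_comp_flow A hg σ 0).sqrt (by rw [flow_zero]; exact hσ.ne')
  simpa using h

theorem differentiableAt_radialExt_log {σ : S2} (hσ : 0 < g σ) :
    DifferentiableAt ℝ (radialExt fun τ => Real.log (g τ)) σ := by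
  have h := (differentiableAt_radialExt hg (coe_ne_zero σ)).log (by rw [radialExt_coe]; exact hσ.ne')
  exact h

theorem lieDeriv_log (A : Skew) {σ : S2} (hσ : 0 < g σ) :
    lieDeriv A (fun τ => Real.log (g τ)) σ = lieDeriv A g σ / g σ := by
  have h1 := hasDerivAt_comp_flow_of_differentiableAt A (Y := fun τ => Real.log (g τ)) σ 0
    (by rw [flow_zero]; exact differentiableAt_radialExt_log hg hσ)
  have h2 := (hasDerivAt_comp_flow A hg σ 0).log (by rw [flow_zero]; exact hσ.ne')
  simpa using h1.unique h2

include hs0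

/-- With f = √g, the logarithmic derivative of g is 2f'/f, and the factor g = f² lowers the exponent
of f in the denominator to 2s. -/
theorem ofReal_mul_lieDeriv_log_rpow (A : Skew) {σ : S2} (hσ : 0 < g σ) :
    ENNReal.ofReal (g σ * |lieDeriv A (fun τ => Real.log (g τ)) σ| ^ (2 + 2 * s)) =
      ENNReal.ofReal (2 ^ (2 + 2 * s)) * liminfQuot s A (fun τ => √(g τ)) σ := by
  have hr : 0 < √(g σ) := Real.sqrt_pos.2 hσ
  rw [liminfQuot_eq hs0 A hg.continuous.sqrt hr (hasDerivAt_sqrt_comp_flow hg A hσ),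
    ← ENNReal.ofReal_mul (by positivity), lieDeriv_log hg A hσ]
  congr 1
  have e : |lieDeriv A g σ / g σ| = 2 * |lieDeriv A g σ / (2 * √(g σ))| / √(g σ) := by
    rw [abs_div, abs_div, abs_of_pos hσ, abs_of_pos (by positivity : 0 < 2 * √(g σ))]
    nth_rewrite 1 [← Real.mul_self_sqrt hσ.le]
    field_simp
  rw [e, Real.div_rpow (by positivity) hr.le, Real.mul_rpow (by norm_num) (abs_nonneg _),
    Real.rpow_add hr, Real.rpow_two, Real.sq_sqrt hσ.le]
  field_simp

/-- The constant 6 is 3, from choosing the best of the nine rotations, times 2, from differentiating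
log g = 2 log √g. Zeros of g contribute nothing because of the factor g. -/
theorem ofReal_mul_norm_sphGradient_log_rpow_le (hg0 : ∀ σ, 0 ≤ g σ) (σ : S2) :
    ENNReal.ofReal (g σ * ‖sphGradient (fun τ => Real.log (g τ)) σ‖ ^ (2 * (1 + s))) ≤
      ENNReal.ofReal (6 ^ (2 + 2 * s)) *
        ∑ j, ∑ k, liminfQuot s (coordRot j k) (fun τ => √(g τ)) σ := by
  rcases (hg0 σ).eq_or_lt with h0 | hσ
  · simp [← h0]
  obtain ⟨j, k, hjk⟩ := norm_sphGradient_le (differentiableAt_radialExt_log hg hσ)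
  rw [show 2 * (1 + s) = 2 + 2 * s by ring]
  calc _ ≤ ENNReal.ofReal (3 ^ (2 + 2 * s) * (g σ *
        |lieDeriv (coordRot j k) (fun τ => Real.log (g τ)) σ| ^ (2 + 2 * s))) := by
        refine ENNReal.ofReal_le_ofReal ?_
        rw [mul_left_comm, ← Real.mul_rpow (by norm_num) (abs_nonneg _)]
        gcongr
    _ = ENNReal.ofReal (6 ^ (2 + 2 * s)) * liminfQuot s (coordRot j k) (fun τ => √(g τ)) σ := by
        rw [ENNReal.ofReal_mul (by positivity), ofReal_mul_lieDeriv_log_rpow hs0 hg _ hσ,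
          ← mul_assoc, ← ENNReal.ofReal_mul (by positivity),
          ← Real.mul_rpow (by norm_num) (by norm_num)]
        norm_num
    _ ≤ _ := by
        gcongr
        exact (Finset.single_le_sum
          (f := fun k => liminfQuot s (coordRot j k) (fun τ => √(g τ)) σ)
          (fun _ _ => zero_le) (Finset.mem_univ k)).trans (Finset.single_le_sum
          (f := fun j => ∑ k, liminfQuot s (coordRot j k) (fun τ => √(g τ)) σ)
          (fun _ _ => zero_le) (Finset.mem_univ j))

theorem fisherJ_le (hs1 : s < 1) (hg0 : ∀ σ, 0 ≤ g σ) :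
    fisherJ s g ≤ ENNReal.ofReal (6 ^ (2 + 2 * s) * 9 * 2 ^ (2 + 2 * s) *
        (2 * (2 / (1 - s) + 4 / s) + 1)) *
      (sobolevSeminorm (1 + s) (sqrtL2 g hg) ^ 2 + eLpNorm g 1 surfaceMeasure) := by
  have hc : Continuous fun τ => √(g τ) := hg.continuous.sqrt
  have hs1' : 0 < 1 - s := by linarith
  have hsq : sqrtL2 g hg = toL2 _ hc := eq_toL2 hc (memLp_sqrt hg).coeFn_toLp
  have hL1 : eLpNorm g 1 surfaceMeasure =
      ∫⁻ σ, ENNReal.ofReal (√(g σ) ^ 2) ∂surfaceMeasure := by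
    rw [eLpNorm_one_eq_lintegral_enorm]
    refine lintegral_congr fun σ => ?_
    rw [Real.sq_sqrt (hg0 σ), Real.enorm_of_nonneg (hg0 σ)]
  rw [sobolevSeminorm_sq, hsq, hL1]
  set S := sobolevSum (1 + s) (toL2 _ hc)
  set N := ∫⁻ σ, ENNReal.ofReal (√(g σ) ^ 2) ∂surfaceMeasure
  set K := 2 / (1 - s) + 4 / s with hK
  have hK0 : 0 < K := by positivity
  have hb (j k : Fin 3) : ∫⁻ σ, liminfQuot s (coordRot j k) (fun τ => √(g τ)) σ ∂surfaceMeasure ≤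
      ENNReal.ofReal (2 ^ (2 + 2 * s)) * (ENNReal.ofReal (2 * K + 1) * (S + N)) := by
    refine (lintegral_liminfQuot_le hs0 hs1 j k hc fun σ => Real.sqrt_nonneg _).trans ?_
    refine mul_le_mul_right ?_ _
    rw [mul_add (ENNReal.ofReal (2 * K + 1))]
    refine add_le_add ?_ ?_
    · rw [← mul_assoc]
      refine mul_le_mul_left ?_ _
      rw [← ENNReal.ofReal_ofNat 2, ← ENNReal.ofReal_mul (by norm_num)]
      exact ENNReal.ofReal_le_ofReal (by linarith)
    · refine le_mul_of_one_le_left zero_le ?_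
      rw [ENNReal.one_le_ofReal]
      linarith
  calc fisherJ s g ≤ ∫⁻ σ, ENNReal.ofReal (6 ^ (2 + 2 * s)) *
        ∑ j, ∑ k, liminfQuot s (coordRot j k) (fun τ => √(g τ)) σ ∂surfaceMeasure :=
        lintegral_mono (ofReal_mul_norm_sphGradient_log_rpow_le hs0 hg hg0)
    _ = ENNReal.ofReal (6 ^ (2 + 2 * s)) * ∑ j, ∑ k,
        ∫⁻ σ, liminfQuot s (coordRot j k) (fun τ => √(g τ)) σ ∂surfaceMeasure := by
        rw [lintegral_const_mul' _ _ ENNReal.ofReal_ne_top, lintegral_finsetSum]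
        · congr 2 with j
          rw [lintegral_finsetSum _ fun k _ => measurable_liminfQuot s _ hc]
        · exact fun j _ => Finset.measurable_fun_sum _ fun k _ => measurable_liminfQuot s _ hc
    _ ≤ ENNReal.ofReal (6 ^ (2 + 2 * s)) * ∑ _j : Fin 3, ∑ _k : Fin 3,
        ENNReal.ofReal (2 ^ (2 + 2 * s)) * (ENNReal.ofReal (2 * K + 1) * (S + N)) := by
        gcongr with j _ k _
        exact hb j k
    _ = _ := by
        rw [ENNReal.ofReal_mul (by positivity), ENNReal.ofReal_mul (by positivity),
          ENNReal.ofReal_mul (by positivity), ENNReal.ofReal_ofNat]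
        simp only [Finset.sum_const, Finset.card_univ, Fintype.card_fin, nsmul_eq_mul]
        push_cast
        ring

end Gradient

end SphereSobolev

end

theorem mainTheorem5 (s : ℝ) (hs0 : 0 < s) (hs1 : s < 1) :
    ∃ C : ℝ, 0 < C ∧ ∀ (g : SphereSobolev.S2 → ℝ) (hg : SphereSobolev.IsSmooth g),
      (∀ σ, 0 ≤ g σ) →
        ENNReal.ofReal C * SphereSobolev.fisherJ s g ≤
          SphereSobolev.sobolevSeminorm (1 + s) (SphereSobolev.sqrtL2 g hg) ^ 2
            + eLpNorm g 1 SphereSobolev.surfaceMeasure := by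
  have hs1' : 0 < 1 - s := by linarith
  set B : ℝ := 6 ^ (2 + 2 * s) * 9 * 2 ^ (2 + 2 * s) * (2 * (2 / (1 - s) + 4 / s) + 1) with hB
  have hB0 : 0 < B := by positivity
  refine ⟨B⁻¹, by positivity, fun g hg hg0 => ?_⟩
  refine (mul_le_mul_right (SphereSobolev.fisherJ_le hs0 hg hs1 hg0) _).trans_eq ?_
  rw [← mul_assoc, ← ENNReal.ofReal_mul (by positivity), inv_mul_cancel₀ hB0.ne',
    ENNReal.ofReal_one, one_mul]
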